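/- An instance of Simultaneous Feedback Edge Set (Sim-FES) consists of a finite undirected graph $G$, possibly with loops and multiple edges, integers $k\ge 0$ and $\alpha\ge 0$, and a coloring function $\mathrm{col}: E(G)\to 2^{[\alpha]}$, where $[\alpha]=\{1,\dots,\alpha\}$. For $i\in[\alpha]$ let $G_i$ be the graph with vertex set $V(G)$ and edge set $\{e\in E(G): i\in \mathrm{col}(e)\}$. The question is whether there is a set $S\subseteq E(G)$ with $|S|\le k$ such that $G_i-S$ is a forest for every $i\in[\alpha]$ (a loop and a pair of parallel edges count as cycles). The parameter is the pair $(k,\alpha)$. **Theorem.** Sim-FES admits a kernel with $(k\alpha)^{\mathcal{O}(\alpha)}$ vertices. That is, there are an absolute constant $c$, a computable function $g:\mathbb{N}^2\to\mathbb{N}$ and an algorithm which, given an instance $(G,k,\mathrm{col}:E(G)\to 2^{[\alpha]})$ of Sim-FES, runs in time polynomial in the size of the instance and returns an instance $(G',k',\mathrm{col}':E(G')\to 2^{[\alpha]})$ of Sim-FES with the same number $\alpha$ of colors and with $k'\le k$, such that 1. $(G',k',\mathrm{col}')$ is a yes-instance if and only if $(G,k,\mathrm{col})$ is a yes-instance;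 2. the size (encoding length) of $(G',k',\mathrm{col}')$ is at most $g(k,\alpha)$; 3. $|V(G')|\le \max\{1,k\alpha\}^{c\alpha}$. Here the size of an instance is the length of its encoding by the numbers $\alpha,k,|V(G)|,|E(G)|$ in binary, the list of the vertices, and the list of the edges, each with its two ends and the characteristic vector of its color set; running time is the number of steps of a random access machine with unit-cost addition and subtraction (and no multiplication). -/

import Mathlib

/-! ### A random access machine with structured control and a step count

Natural-number registers and finitely many natural-number arrays per program; the arithmetic
is addition and truncated subtraction only (no multiplication), at unit cost, so that one step
lengthens the binary expansion of a number by at most one bit. Output is written value by value. -/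

namespace RAM

/-- Arithmetic expressions over the memory of the machine. -/
inductive Expr : Type where
  | const (c : ℕ)
  | var (r : ℕ)
  | arr (a : ℕ) (i : Expr)
  | add (e₁ e₂ : Expr)
  | sub (e₁ e₂ : Expr)

/-- Programs. Conditionals and loops test whether an expression is nonzero. -/
inductive Prog : Type where
  | skip
  | assign (r : ℕ) (e : Expr)
  | store (a : ℕ) (i e : Expr)
  | write (e : Expr)
  | seq (p q : Prog)
  | ite (e : Expr) (p q : Prog)
  | loop (e : Expr) (p : Prog)

/-- Memory: registers, arrays, and the output written so far. -/
structure State : Type where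
  var : ℕ → ℕ
  arr : ℕ → ℕ → ℕ
  out : List ℕ

/-- The value of an expression. -/
def Expr.eval (s : State) : Expr → ℕ
  | const c => c
  | var r => s.var r
  | arr a i => s.arr a (i.eval s)
  | add e₁ e₂ => e₁.eval s + e₂.eval s
  | sub e₁ e₂ => e₁.eval s - e₂.eval s

/-- The number of steps needed to evaluate an expression: one per operation. -/
def Expr.cost : Expr → ℕ
  | const _ => 1
  | var _ => 1
  | arr _ i => i.cost + 1
  | add e₁ e₂ => e₁.cost + e₂.cost + 1
  | sub e₁ e₂ => e₁.cost + e₂.cost + 1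

/-- `Exec p s t s'`: program `p`, started in state `s`, halts after exactly `t` steps in state
`s'`. -/
inductive Exec : Prog → State → ℕ → State → Prop where
  | skip (s : State) : Exec .skip s 1 s
  | assign (r : ℕ) (e : Expr) (s : State) :
      Exec (.assign r e) s (e.cost + 1) { s with var := Function.update s.var r (e.eval s) }
  | store (a : ℕ) (i e : Expr) (s : State) :
      Exec (.store a i e) s (i.cost + e.cost + 1)
        { s with arr := Function.update s.arr a
                  (Function.update (s.arr a) (i.eval s) (e.eval s)) }
  | write (e : Expr) (s : State) :
      Exec (.write e) s (e.cost + 1) { s with out := s.out ++ [e.eval s] }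
  | seq {p q : Prog} {s s' s'' : State} {t t' : ℕ} (hp : Exec p s t s') (hq : Exec q s' t' s'') :
      Exec (.seq p q) s (t + t' + 1) s''
  | ite_true {e : Expr} {p q : Prog} {s s' : State} {t : ℕ} (he : e.eval s ≠ 0)
      (hp : Exec p s t s') : Exec (.ite e p q) s (e.cost + t + 1) s'
  | ite_false {e : Expr} {p q : Prog} {s s' : State} {t : ℕ} (he : e.eval s = 0)
      (hq : Exec q s t s') : Exec (.ite e p q) s (e.cost + t + 1) s'
  | loop_done {e : Expr} {p : Prog} {s : State} (he : e.eval s = 0) :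
      Exec (.loop e p) s (e.cost + 1) s
  | loop_step {e : Expr} {p : Prog} {s s' s'' : State} {t t' : ℕ} (he : e.eval s ≠ 0)
      (hp : Exec p s t s') (hl : Exec (.loop e p) s' t' s'') :
      Exec (.loop e p) s (e.cost + t + t' + 1) s''

/-- The initial memory on input `l`: array `0` holds `l`, register `0` holds the length of `l`,
everything else is zero, and nothing has been written. -/
def State.init (l : List ℕ) : State where
  var := Function.update (fun _ => 0) 0 l.length
  arr := Function.update (fun _ _ => 0) 0 (fun i => l.getD i 0)
  out := []

/-- The length of a list of numbers, written in binary with a separator after each number. -/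
def bitLength (l : List ℕ) : ℕ := (l.map fun x => Nat.size x + 1).sum

/-- `f` is computed, with respect to the given encodings, by a program whose number of steps is
bounded by a polynomial in the length of the encoded input. -/
def PolyTimeComputable {A B : Type*} (encA : A → List ℕ) (encB : B → List ℕ) (f : A → B) : Prop :=
  ∃ (p : Prog) (q : Polynomial ℕ), ∀ x : A, ∃ (t : ℕ) (s : State),
    Exec p (State.init (encA x)) t s ∧ s.out = encB (f x) ∧ t ≤ q.eval (bitLength (encA x))

end RAM

/-- `K` is a kernelization for the problem with set `yes` of yes-instances, with respect to the
encoding `enc` of the instances and the parameter `param`: it runs in polynomial time, maps every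
instance to an equivalent one, and the size of its output is bounded by a computable function of
the parameter of the input. -/
def IsKernelization {I P : Type*} [Primcodable P] (enc : I → List ℕ) (yes : I → Prop)
    (param : I → P) (K : I → I) : Prop :=
  RAM.PolyTimeComputable enc enc K ∧
    (∀ x, yes (K x) ↔ yes x) ∧
    ∃ g : P → ℕ, Computable g ∧ ∀ x, RAM.bitLength (enc (K x)) ≤ g (param x)

/-- A multigraph is a forest if it has no cycle: there are no distinct vertices `v 0, …, v L` and
distinct edges `e 0, …, e L` such that `e j` joins `v j` to `v (j + 1)`, indices modulo `L + 1`.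
A loop (`L = 0`) and a pair of parallel edges (`L = 1`) are cycles. -/
def Graph.NoCycle {V E : Type*} (G : Graph V E) : Prop :=
  ¬ ∃ (L : ℕ) (v : Fin (L + 1) → V) (e : Fin (L + 1) → E),
    Function.Injective v ∧ Function.Injective e ∧ ∀ j, G.IsLink (e j) (v j) (v (j + 1))

namespace SimFES

/-- An instance: a finite graph, possibly with loops and multiple edges, in which every edge
carries a set of colours from `Fin numColors`, and a budget `k`. Edge `e` joins the two entries of
`ends e`, whose order is irrelevant. -/
structure Instance : Type where
  numColors : ℕ
  budget : ℕ
  numVertices : ℕ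
  numEdges : ℕ
  ends : Fin numEdges → Fin numVertices × Fin numVertices
  col : Fin numEdges → Finset (Fin numColors)

/-- The graph of an instance. -/
def Instance.graph (I : Instance) : Graph (Fin I.numVertices) (Fin I.numEdges) where
  vertexSet := Set.univ
  IsLink e x y := I.ends e = (x, y) ∨ I.ends e = (y, x)
  isLink_symm _ _ := ⟨fun _ _ h => h.symm⟩
  eq_or_eq_of_isLink_of_isLink := by
    rintro e x y v w (h | h) (h' | h') <;> simp_all
  left_mem_of_isLink := by simp

/-- The graph `G_i` of colour `i`: all vertices, and the edges whose colour set contains `i`. -/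
def Instance.colorGraph (I : Instance) (i : Fin I.numColors) :
    Graph (Fin I.numVertices) (Fin I.numEdges) :=
  I.graph.restrict {e | i ∈ I.col e}

/-- `S` is a simultaneous feedback edge set: `G_i - S` is a forest for every colour `i`. -/
def Instance.IsSimFES (I : Instance) (S : Finset (Fin I.numEdges)) : Prop :=
  ∀ i : Fin I.numColors, ((I.colorGraph i).deleteEdges (S : Set (Fin I.numEdges))).NoCycle

/-- Yes-instances: there is a simultaneous feedback edge set of cardinality at most `k`. -/
def Instance.IsYes (I : Instance) : Prop :=
  ∃ S : Finset (Fin I.numEdges), I.IsSimFES S ∧ S.card ≤ I.budget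

/-- The parameter is the pair `(k, α)`. -/
def Instance.param (I : Instance) : ℕ × ℕ := (I.budget, I.numColors)

/-- The encoding of an instance: the numbers `α`, `k`, `|V|`, `|E|`, the list of all vertices, and
the list of all edges, each given by its two ends and the characteristic vector of its colour
set. -/
def Instance.encode (I : Instance) : List ℕ :=
  [I.numColors, I.budget, I.numVertices, I.numEdges] ++ List.range I.numVertices ++
    (List.finRange I.numEdges).flatMap fun e =>
      [((I.ends e).1 : ℕ), ((I.ends e).2 : ℕ)] ++
        (List.finRange I.numColors).map fun i => if i ∈ I.col e then 1 else 0

end SimFES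

/-! Orient every edge and give it the incidence vector `single x 1 - single y 1` over ℚ. An edge set
is a forest exactly when its incidence vectors are linearly independent, so the problem asks for at
most `k` elements whose deletion makes `α` families of vectors independent. Let the nullity of a
colour be its cyclomatic number. If the nullities sum to at most `k`, deleting the complement of a
spanning forest in each colour is a solution; if one of them exceeds `k`, there is none. Otherwise
every nullity is at most `k`.

Call two edges in series in colour `i` if every relation among the edges of that colour involves
both or neither. A colour of nullity `ν` has at most `3 * ν + 1` such classes
(`card_quotient_series_le`): take one edge from each class that occurs in a relation and contract
the other edges of the colour. Every vertex met by a remaining non-loop edge then meets at least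
three of them, because a cut with one edge or two would make an edge irrelevant or put two edges in
series. Intersecting the classes of all colours leaves at most `(3 * k + 1) ^ α` common classes
(`numReps_le`), and a solution needs only one representative edge from each class it meets.

The other edges are never deleted and are acyclic in every colour, but their contraction depends on
the colour. It is simulated: each representative becomes an edge between two private new vertices,
and in colour `i` every new vertex is linked to a canonical new vertex, its anchor, in the same
component of the non-representatives. The links form stars, and their contraction leaves the same
vectors as the contraction of the non-representatives. Deleting a link is no better than deleting
the representative owning its vertex, since without that edge the link lies on no cycle of its
colour (`Compression.solvable_iff`). In this case `k ≥ 1` and `α ≥ 2`, so the `2 * (3 * k + 1) ^ α`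
vertices obey the required bound with `c = 4`.

For the running time, components and nullities are found by relabelling, and `series_iff_nullity`
reduces the series test to three nullities. A small program logic certifies both the output and a
polynomial bound on the steps. -/

/-! ### Linear relations in a finite family of vectors -/

namespace SimFES

section Family

variable {E X : Type*} [AddCommGroup X] [Module ℚ X]

/-- The dimension of the span of the vectors `v e` with `e ∈ A`. -/
noncomputable def rank (v : E → X) (A : Finset E) : ℕ :=
  Module.finrank ℚ (Submodule.span ℚ (v '' (A : Set E)))

/-- The dimension of the space of relations between the vectors `v e` with `e ∈ A`. -/
noncomputable def nullity (v : E → X) (A : Finset E) : ℕ := A.card - rank v A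

lemma finiteDimensional_span (v : E → X) (A : Finset E) :
    FiniteDimensional ℚ (Submodule.span ℚ (v '' (A : Set E))) :=
  FiniteDimensional.span_of_finite ℚ (A.finite_toSet.image v)

lemma rank_le_card (v : E → X) (A : Finset E) : rank v A ≤ A.card := by
  classical
  have h := finrank_span_finset_le_card (R := ℚ) (A.image v)
  rw [Finset.coe_image] at h
  exact h.trans Finset.card_image_le

lemma rank_mono (v : E → X) {A B : Finset E} (h : A ⊆ B) : rank v A ≤ rank v B := by
  have := finiteDimensional_span v B
  exact Submodule.finrank_mono (Submodule.span_mono (Set.image_mono (by exact_mod_cast h)))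

lemma rank_eq_card {v : E → X} {A : Finset E} (h : LinearIndepOn ℚ v (A : Set E)) :
    rank v A = A.card := by
  have := finrank_span_eq_card (R := ℚ) h.linearIndependent
  rw [rank, Set.image_eq_range, ← Fintype.card_coe A]
  exact this

lemma exists_basis (v : E → X) (A : Finset E) :
    ∃ B ⊆ A, LinearIndepOn ℚ v (B : Set E) ∧ B.card = rank v A := by
  classical
  obtain ⟨b, hbA, -, hspan, hb⟩ :=
    exists_linearIndepOn_extension (linearIndepOn_empty ℚ v) (Set.empty_subset (A : Set E))
  have hfin : b.Finite := A.finite_toSet.subset hbA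
  lift b to Finset E using hfin
  refine ⟨b, by exact_mod_cast hbA, hb, ?_⟩
  rw [← rank_eq_card hb, rank, rank]
  rw [le_antisymm (Submodule.span_mono (Set.image_mono hbA)) (Submodule.span_le.2 hspan)]

/-- Vectors spanning the kernel of a linear map may be contracted. -/
lemma linearIndepOn_union_iff_of_ker {Y : Type*} [AddCommGroup Y] [Module ℚ Y] {v : E → X}
    {s t : Set E} (hst : Disjoint s t) (hs : LinearIndepOn ℚ v s) (f : X →ₗ[ℚ] Y)
    (hf : LinearMap.ker f = Submodule.span ℚ (v '' s)) :
    LinearIndepOn ℚ v (s ∪ t) ↔ LinearIndepOn ℚ (fun e => f (v e)) t := by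
  rw [linearIndepOn_union_iff_quotient hst, and_iff_right hs, ← hf]
  have hinj : LinearMap.ker ((LinearMap.ker f).liftQ f le_rfl) = ⊥ :=
    Submodule.ker_liftQ_eq_bot _ _ _ le_rfl
  have := LinearMap.linearIndependent_iff (v := fun e : t => (LinearMap.ker f).mkQ (v e)) _ hinj
  exact this.symm

variable [DecidableEq E]

lemma rank_insert_of_mem {v : E → X} {A : Finset E} {e : E}
    (h : v e ∈ Submodule.span ℚ (v '' (A : Set E))) : rank v (insert e A) = rank v A := by
  rw [rank, rank, Finset.coe_insert, Set.image_insert_eq, Submodule.span_insert_eq_span h]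

lemma rank_insert_of_notMem {v : E → X} {A : Finset E} {e : E}
    (h : v e ∉ Submodule.span ℚ (v '' (A : Set E))) : rank v (insert e A) = rank v A + 1 := by
  obtain ⟨B, hBA, hB, hc⟩ := exists_basis v A
  have hspan : Submodule.span ℚ (v '' (B : Set E)) = Submodule.span ℚ (v '' (A : Set E)) := by
    have := finiteDimensional_span v A
    refine Submodule.eq_of_le_of_finrank_eq
      (Submodule.span_mono (Set.image_mono (by exact_mod_cast hBA))) ?_
    exact (rank_eq_card hB).trans hc
  have heB : e ∉ B := fun he => h (Submodule.subset_span ⟨e, hBA he, rfl⟩)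
  have hins : LinearIndepOn ℚ v ((insert e B : Finset E) : Set E) := by
    rw [Finset.coe_insert]
    exact hB.insert (hspan ▸ h)
  have h1 := rank_eq_card hins
  rw [Finset.card_insert_of_notMem heB, hc] at h1
  rw [← h1, rank, rank, Finset.coe_insert, Finset.coe_insert, Set.image_insert_eq,
    Set.image_insert_eq, Submodule.span_insert, Submodule.span_insert, hspan]

/-- Together with `nullity_insert_of_notMem` this is the update rule of the program: the counter
grows exactly when the new edge joins two vertices that are already connected. -/
lemma nullity_insert_of_mem {v : E → X} {A : Finset E} {e : E} (he : e ∉ A)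
    (h : v e ∈ Submodule.span ℚ (v '' (A : Set E))) :
    nullity v (insert e A) = nullity v A + 1 := by
  have := rank_le_card v A
  rw [nullity, nullity, rank_insert_of_mem h, Finset.card_insert_of_notMem he]
  omega

lemma nullity_insert_of_notMem {v : E → X} {A : Finset E} {e : E} (he : e ∉ A)
    (h : v e ∉ Submodule.span ℚ (v '' (A : Set E))) :
    nullity v (insert e A) = nullity v A := by
  rw [nullity, nullity, rank_insert_of_notMem h, Finset.card_insert_of_notMem he]
  omega

variable [Fintype E]

/-- The coefficients `c` form a linear relation between the vectors `v e` with `e ∈ A`. -/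
def IsRelation (v : E → X) (A : Finset E) (c : E → ℚ) : Prop :=
  (∀ e ∉ A, c e = 0) ∧ ∑ e, c e • v e = 0

lemma linearIndepOn_iff_isRelation (v : E → X) (A : Finset E) :
    LinearIndepOn ℚ v (A : Set E) ↔ ∀ c, IsRelation v A c → ∀ e, c e = 0 := by
  rw [linearIndepOn_iff'']
  constructor
  · rintro h c ⟨hc, hs⟩ e
    by_cases he : e ∈ A
    swap
    · exact hc e he
    refine h A c subset_rfl hc ?_ e he
    rw [← hs]
    exact Finset.sum_subset (Finset.subset_univ _) fun x _ hx => by simp [hc x hx]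
  · intro h t g ht hg hs e _
    refine h g ⟨fun e he => hg e fun h' => he (ht h'), ?_⟩ e
    rw [← hs]
    exact (Finset.sum_subset (Finset.subset_univ _) fun x _ hx => by simp [hg x hx]).symm

lemma isRelation_erase_iff {v : E → X} {A : Finset E} {e : E} {c : E → ℚ} :
    IsRelation v (A.erase e) c ↔ IsRelation v A c ∧ c e = 0 := by
  constructor
  · rintro ⟨h, hs⟩
    exact ⟨⟨fun x hx => h x fun hx' => hx (Finset.mem_of_mem_erase hx'), hs⟩, h e (by simp)⟩
  · rintro ⟨⟨h, hs⟩, he⟩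
    refine ⟨fun x hx => ?_, hs⟩
    by_cases hxe : x = e
    · exact hxe ▸ he
    · exact h x fun hx' => hx (Finset.mem_erase.2 ⟨hxe, hx'⟩)

lemma mem_span_iff_isRelation {v : E → X} {A : Finset E} {e : E} (he : e ∉ A) :
    v e ∈ Submodule.span ℚ (v '' (A : Set E)) ↔
      ∃ c, IsRelation v (insert e A) c ∧ c e ≠ 0 := by
  constructor
  · intro h
    rw [Submodule.mem_span_image_finset_iff_exists_fun'] at h
    obtain ⟨c, hc⟩ := h
    refine ⟨fun x => if x = e then -1 else if x ∈ A then c x else 0, ⟨?_, ?_⟩, by simp⟩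
    · intro x hx
      simp only [Finset.mem_insert, not_or] at hx
      simp [hx.1, hx.2]
    · rw [← Finset.sum_subset (Finset.subset_univ (insert e A)), Finset.sum_insert he]
      · have : ∑ x ∈ A, (if x = e then (-1 : ℚ) else if x ∈ A then c x else 0) • v x =
            ∑ x ∈ A, c x • v x := by
          refine Finset.sum_congr rfl fun x hx => ?_
          have : x ≠ e := fun h => he (h ▸ hx)
          simp [this, hx]
        rw [this, hc]
        simp
      · intro x _ hx
        simp only [Finset.mem_insert, not_or] at hx
        simp [hx.1, hx.2]
  · rintro ⟨c, ⟨hc, hs⟩, hce⟩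
    have h1 : c e • v e = - ∑ x ∈ A, c x • v x := by
      rw [eq_neg_iff_add_eq_zero, ← Finset.sum_insert (f := fun x => c x • v x) he, ← hs]
      exact Finset.sum_subset (Finset.subset_univ _) fun x _ hx => by simp [hc x hx]
    have h2 : c e • v e ∈ Submodule.span ℚ (v '' (A : Set E)) := by
      rw [h1]
      refine Submodule.neg_mem _ (Submodule.sum_mem _ fun x hx => Submodule.smul_mem _ _ ?_)
      exact Submodule.subset_span ⟨x, hx, rfl⟩
    exact (Submodule.smul_mem_iff _ hce).1 h2

/-- If `e` occurs in a relation, the other vectors span `v e`, and erasing `e` lowers the nullity by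
one; otherwise `e` is a coloop and erasing it lowers the rank instead. -/
lemma nullity_erase_eq_iff {v : E → X} {A : Finset E} {e : E} :
    nullity v (A.erase e) = nullity v A ↔ ∀ c, IsRelation v A c → c e = 0 := by
  by_cases he : e ∈ A
  · have hn : e ∉ A.erase e := by simp
    have h0 := mem_span_iff_isRelation (v := v) hn
    rw [Finset.insert_erase he] at h0
    by_cases h : v e ∈ Submodule.span ℚ (v '' ((A.erase e : Finset E) : Set E))
    · have h1 := nullity_insert_of_mem hn h
      rw [Finset.insert_erase he] at h1
      obtain ⟨c, hc, hce⟩ := h0.1 h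
      constructor
      · omega
      · intro h'
        exact absurd (h' c hc) hce
    · have h1 := nullity_insert_of_notMem hn h
      rw [Finset.insert_erase he] at h1
      refine ⟨fun _ c hc => ?_, fun _ => h1.symm⟩
      by_contra hce
      exact h (h0.2 ⟨c, hc, hce⟩)
  · rw [Finset.erase_eq_of_notMem he]
    exact ⟨fun _ c hc => hc.1 e he, fun _ => rfl⟩

/-- Two elements are in series when every relation involves both or neither of them. -/
lemma series_iff_nullity {v : E → X} {A : Finset E} {e f : E} :
    (∀ c, IsRelation v A c → (c e = 0 ↔ c f = 0)) ↔
      nullity v ((A.erase e).erase f) = nullity v (A.erase e) ∧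
        nullity v ((A.erase e).erase f) = nullity v (A.erase f) := by
  -- A relation on `A.erase e` is one on `A` that vanishes at `e`, so each equation says that
  -- vanishing at one element forces vanishing at the other.
  rw [nullity_erase_eq_iff, Finset.erase_right_comm, nullity_erase_eq_iff]
  simp only [isRelation_erase_iff]
  constructor
  · intro h
    exact ⟨fun c hc => (h c hc.1).1 hc.2, fun c hc => (h c hc.1).2 hc.2⟩
  · intro h c hc
    exact ⟨fun h' => h.1 c ⟨hc, h'⟩, fun h' => h.2 c ⟨hc, h'⟩⟩

end Family

end SimFES

/-! ### Incidence vectors and acyclic edge sets -/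

namespace SimFES

section Incidence

variable {V W E : Type*}

/-- The difference of the unit vectors at two vertices. -/
noncomputable def diff (x y : V) : V →₀ ℚ := Finsupp.single x 1 - Finsupp.single y 1

/-- The incidence vector of an edge. -/
noncomputable def inc (ends : E → V × V) (e : E) : V →₀ ℚ := diff (ends e).1 (ends e).2

@[simp] lemma diff_self (x : V) : diff x x = 0 := sub_self _

lemma diff_add_diff (x y z : V) : diff x y + diff y z = diff x z := sub_add_sub_cancel _ _ _

lemma neg_diff (x y : V) : -diff x y = diff y x := neg_sub _ _

lemma mapDomain_diff (f : V → W) (x y : V) :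
    Finsupp.lmapDomain ℚ ℚ f (diff x y) = diff (f x) (f y) := by
  simp [diff, map_sub, Finsupp.mapDomain_single]

lemma diff_eq_zero_iff {x y : V} : diff x y = 0 ↔ x = y := by
  rw [diff, sub_eq_zero, Finsupp.single_left_inj one_ne_zero]

/-- The coordinate sum over a set of vertices. -/
noncomputable def sumOn (S : Set V) : (V →₀ ℚ) →ₗ[ℚ] ℚ :=
  Finsupp.linearCombination ℚ (S.indicator 1)

lemma sumOn_diff (S : Set V) (x y : V) :
    sumOn S (diff x y) = S.indicator 1 x - S.indicator 1 y := by
  simp [sumOn, diff, map_sub, Finsupp.linearCombination_single]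

/-- The subspace spanned by the incidence vectors of a set of edges. -/
noncomputable def incSpan (ends : E → V × V) (C : Set E) : Submodule ℚ (V →₀ ℚ) :=
  Submodule.span ℚ (inc ends '' C)

/-- A map on the vertices whose fibres are the connected components of an edge set. -/
structure IsLabelling (ends : E → V × V) (C : Set E) (lab : V → W) : Prop where
  edge : ∀ e ∈ C, lab (ends e).1 = lab (ends e).2
  conn : ∀ x y, lab x = lab y → diff x y ∈ incSpan ends C

lemma inc_mem_incSpan {ends : E → V × V} {C : Set E} {e : E} (he : e ∈ C) :
    inc ends e ∈ incSpan ends C := Submodule.subset_span ⟨e, he, rfl⟩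

lemma incSpan_mono {ends : E → V × V} {C D : Set E} (h : C ⊆ D) :
    incSpan ends C ≤ incSpan ends D := Submodule.span_mono (Set.image_mono h)

lemma incSpan_le_ker {ends : E → V × V} {C : Set E} {lab : V → W}
    (h : ∀ e ∈ C, lab (ends e).1 = lab (ends e).2) :
    incSpan ends C ≤ LinearMap.ker (Finsupp.lmapDomain ℚ ℚ lab) := by
  rw [incSpan, Submodule.span_le]
  rintro _ ⟨e, he, rfl⟩
  rw [SetLike.mem_coe, LinearMap.mem_ker, inc, mapDomain_diff, diff_eq_zero_iff]
  exact h e he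

lemma IsLabelling.eq_iff {ends : E → V × V} {C : Set E} {lab : V → W}
    (h : IsLabelling ends C lab) (x y : V) : lab x = lab y ↔ diff x y ∈ incSpan ends C := by
  refine ⟨h.conn x y, fun hxy => ?_⟩
  have := incSpan_le_ker h.edge hxy
  rwa [LinearMap.mem_ker, mapDomain_diff, diff_eq_zero_iff] at this

lemma IsLabelling.ker_eq {ends : E → V × V} {C : Set E} {lab : V → W}
    (h : IsLabelling ends C lab) :
    LinearMap.ker (Finsupp.lmapDomain ℚ ℚ lab) = incSpan ends C := by
  refine le_antisymm (fun z hz => ?_) (incSpan_le_ker h.edge)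
  rcases isEmpty_or_nonempty V with hV | hV
  · have : z = 0 := Subsingleton.elim _ _
    rw [this]
    exact zero_mem _
  -- Moving all mass to one chosen vertex in each fibre changes `z` by an element of the span. If
  -- `lab` kills `z`, nothing is left after the move.
  have key : z - Finsupp.lmapDomain ℚ ℚ (Function.invFun lab) (Finsupp.lmapDomain ℚ ℚ lab z) ∈
      incSpan ends C := by
    clear hz
    induction z using Finsupp.induction_linear with
    | zero => simp
    | add f g hf hg =>
      rw [map_add, map_add, add_sub_add_comm]
      exact add_mem hf hg
    | single x a =>
      have hx : lab (Function.invFun lab (lab x)) = lab x := Function.invFun_eq ⟨x, rfl⟩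
      have := Submodule.smul_mem _ a (h.conn _ _ hx.symm)
      simpa [diff, smul_sub, Finsupp.mapDomain_single] using this
  rw [LinearMap.mem_ker] at hz
  rwa [hz, map_zero, sub_zero] at key

/-- Contraction of an acyclic edge set. -/
lemma IsLabelling.linearIndepOn_union_iff {ends : E → V × V} {C : Set E} {lab : V → W}
    (h : IsLabelling ends C lab) (hC : LinearIndepOn ℚ (inc ends) C) {D : Set E}
    (hCD : Disjoint C D) :
    LinearIndepOn ℚ (inc ends) (C ∪ D) ↔
      LinearIndepOn ℚ (inc fun e => (lab (ends e).1, lab (ends e).2)) D := by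
  rw [linearIndepOn_union_iff_of_ker hCD hC _ h.ker_eq]
  simp only [inc, mapDomain_diff]
  rfl

lemma isLabelling_empty (ends : E → V × V) {f : V → W} (hf : Function.Injective f) :
    IsLabelling ends ∅ f where
  edge := by simp
  conn x y hxy := by rw [hf hxy, diff_self]; exact zero_mem _

/-- The canonical labelling: a vertex is mapped to the class of the vertices connected to it. -/
def connSetoid (ends : E → V × V) (C : Set E) : Setoid V where
  r x y := diff x y ∈ incSpan ends C
  iseqv :=
    ⟨fun x => by rw [diff_self]; exact zero_mem _,
      fun {x y} h => by rw [← neg_diff]; exact neg_mem h,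
      fun {x y z} h h' => by rw [← diff_add_diff x y z]; exact add_mem h h'⟩

lemma isLabelling_mk (ends : E → V × V) (C : Set E) :
    IsLabelling ends C (Quotient.mk (connSetoid ends C)) where
  edge _ he := Quotient.sound (inc_mem_incSpan he)
  conn _ _ h := Quotient.exact h

end Incidence

/-! ### Forests are the edge sets with independent incidence vectors. -/

section Cycle

variable {V E : Type*}

lemma IsLink.exists_sign {ends : E → V × V} {e : E} {x y : V}
    (h : ends e = (x, y) ∨ ends e = (y, x)) :
    ∃ s : ℚ, s ≠ 0 ∧ s • inc ends e = diff x y := by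
  rcases h with h | h
  · exact ⟨1, one_ne_zero, by rw [inc, h, one_smul]⟩
  · exact ⟨-1, by norm_num, by rw [inc, h, neg_one_smul, neg_diff]⟩

/-- Around a cycle the differences, with signs for the orientation, telescope to zero, because the
cyclic shift permutes the indices; this is a nontrivial relation. -/
lemma noCycle_of_linearIndepOn {G : Graph V E} {ends : E → V × V} {A : Set E}
    (hG : ∀ e x y, G.IsLink e x y ↔ (ends e = (x, y) ∨ ends e = (y, x)) ∧ e ∈ A)
    (h : LinearIndepOn ℚ (inc ends) A) : G.NoCycle := by
  rintro ⟨L, v, e, -, he, hl⟩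
  simp only [hG] at hl
  choose s hs0 hs using fun j => IsLink.exists_sign (hl j).1
  have hli : LinearIndependent ℚ (fun j => inc ends (e j)) := by
    have := h.linearIndependent.comp (fun j => (⟨e j, (hl j).2⟩ : A))
      (fun a b hab => he (congrArg Subtype.val hab))
    exact this
  rw [Fintype.linearIndependent_iff] at hli
  refine hs0 0 (hli s ?_ 0)
  simp only [hs, diff, Finset.sum_sub_distrib]
  rw [sub_eq_zero]
  exact (Equiv.sum_comp (Equiv.addRight (1 : Fin (L + 1)))
    (fun j => Finsupp.single (v j) (1 : ℚ))).symm

/-- Vertices connected by edges are joined by a walk in the underlying simple graph. -/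
lemma reachable_of_diff_mem {ends : E → V × V} {A : Set E} {x y : V}
    (h : diff x y ∈ incSpan ends A) :
    (SimpleGraph.fromRel fun x y => ∃ e ∈ A, ends e = (x, y)).Reachable x y := by
  set H := SimpleGraph.fromRel fun x y => ∃ e ∈ A, ends e = (x, y)
  have := incSpan_le_ker (lab := H.connectedComponentMk) (fun e he => ?_) h
  · rw [LinearMap.mem_ker, mapDomain_diff, diff_eq_zero_iff] at this
    exact SimpleGraph.ConnectedComponent.exact this
  · by_cases hne : (ends e).1 = (ends e).2
    · rw [hne]
    · refine SimpleGraph.ConnectedComponent.sound (SimpleGraph.Adj.reachable ?_)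
      exact ⟨hne, Or.inl ⟨e, he, rfl⟩⟩

/-- If the vector of `f` is spanned by the others, the ends of `f` are joined by a path avoiding
`f`, and `f` closes it to a cycle. -/
lemma linearIndepOn_of_noCycle {G : Graph V E} {ends : E → V × V} {A : Set E}
    (hG : ∀ e x y, G.IsLink e x y ↔ (ends e = (x, y) ∨ ends e = (y, x)) ∧ e ∈ A)
    (h : G.NoCycle) : LinearIndepOn ℚ (inc ends) A := by
  by_contra hA
  rw [linearIndepOn_iff_notMem_span] at hA
  push Not at hA
  obtain ⟨f, hfA, hf⟩ := hA
  obtain ⟨p, hp⟩ := (reachable_of_diff_mem (ends := ends) (A := A \ {f}) hf).exists_isPath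
  apply h
  have hadj : ∀ j < p.length, ∃ e ∈ A \ {f},
      ends e = (p.getVert j, p.getVert (j + 1)) ∨ ends e = (p.getVert (j + 1), p.getVert j) := by
    intro j hj
    obtain ⟨-, ⟨e, he, h'⟩ | ⟨e, he, h'⟩⟩ := p.adj_getVert_succ hj
    · exact ⟨e, he, Or.inl h'⟩
    · exact ⟨e, he, Or.inr h'⟩
  have : Nonempty E := ⟨f⟩
  choose! g hgA hg using hadj
  have hinj : ∀ i j, i ≤ p.length → j ≤ p.length → p.getVert i = p.getVert j → i = j :=
    fun i j hi hj hij => hp.getVert_injOn hi hj hij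
  -- The last index carries `f`; if `f` is a loop, the path is trivial and this is the only index.
  -- Path edges are distinct because their pairs of ends are.
  refine ⟨p.length, fun j => p.getVert j, fun j => if (j : ℕ) < p.length then g j else f,
    ?_, ?_, ?_⟩
  · intro i j hij
    exact Fin.ext (hinj _ _ (by omega) (by omega) hij)
  · intro i j hij
    dsimp only at hij
    split_ifs at hij with hi hj hj
    · have h1 := hg _ hi
      have h2 := hg _ hj
      rw [hij] at h1
      apply Fin.ext
      rcases h1 with h1 | h1 <;> rcases h2 with h2 | h2 <;>
        rw [h1, Prod.mk.injEq] at h2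
      · exact hinj _ _ (by omega) (by omega) h2.1
      · have a := hinj _ _ (by omega) (by omega) h2.1
        have b := hinj _ _ (by omega) (by omega) h2.2
        omega
      · have a := hinj _ _ (by omega) (by omega) h2.1
        have b := hinj _ _ (by omega) (by omega) h2.2
        omega
      · exact hinj _ _ (by omega) (by omega) h2.2
    · exact absurd hij (hgA _ hi).2
    · exact absurd hij.symm (hgA _ hj).2
    · exact Fin.ext (by omega)
  · intro j
    rw [hG]
    by_cases hj : (j : ℕ) < p.length
    · have hj' : ((j + 1 : Fin (p.length + 1)) : ℕ) = j + 1 := by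
        rw [Fin.val_add_one, if_neg]
        intro h'
        rw [h', Fin.val_last] at hj
        omega
      simp only [hj, if_true, hj']
      exact ⟨hg _ hj, (hgA _ hj).1⟩
    · have hl : j = Fin.last _ := Fin.ext (by rw [Fin.val_last]; omega)
      simp only [hj, if_false]
      refine ⟨Or.inr ?_, hfA⟩
      rw [hl]
      simp

end Cycle

end SimFES

/-! ### Series classes -/

namespace SimFES

section Series

variable {E X V : Type*} [AddCommGroup X] [Module ℚ X]

/-- Double counting of incidences: an edge has at most two ends, and each vertex counted here lies
on at least three edges. -/
lemma three_mul_card_le_of_degree {W : Type*} [DecidableEq W] (N : Finset E) (a b : E → W)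
    (h : ∀ w ∈ N.image a ∪ N.image b, 3 ≤ (N.filter fun e => a e = w ∨ b e = w).card) :
    3 * (N.image a ∪ N.image b).card ≤ 2 * N.card := by
  classical
  have h1 := Finset.sum_card_bipartiteAbove_eq_sum_card_bipartiteBelow
    (s := N) (t := N.image a ∪ N.image b) (fun e w => a e = w ∨ b e = w)
  have h2 := Finset.card_nsmul_le_sum (N.image a ∪ N.image b)
    (fun w => (Finset.bipartiteBelow (fun e w => a e = w ∨ b e = w) N w).card) 3
    (fun w hw => h w hw)
  have h3 := Finset.sum_le_card_nsmul N
    (fun e => (Finset.bipartiteAbove (fun e w => a e = w ∨ b e = w)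
      (N.image a ∪ N.image b) e).card) 2 fun e _ => by
      refine (Finset.card_le_card (t := {a e, b e}) fun w hw => ?_).trans Finset.card_le_two
      obtain ⟨-, h | h⟩ := Finset.mem_filter.1 hw <;> simp [h]
  simp only [smul_eq_mul] at h2 h3
  omega

/-- The vectors of `C` and one unit vector for each class in `T` span everything: an edge inside a
class is spanned by `C`, and any other is a difference of two unit vectors, each of which `C` moves
to the chosen vertex of its class. -/
lemma rank_le_card_add_card [DecidableEq E] {ends : E → V × V} {A C : Finset E} {W : Type*}
    {cl : V → W} (hcl : IsLabelling ends (C : Set E) cl) {T : Finset W}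
    (hT : ∀ e ∈ A, cl (ends e).1 ≠ cl (ends e).2 → cl (ends e).1 ∈ T ∧ cl (ends e).2 ∈ T) :
    rank (inc ends) A ≤ C.card + T.card := by
  classical
  rcases isEmpty_or_nonempty V with hV | hV
  · have := rank_le_card (inc ends) A
    rcases A.eq_empty_or_nonempty with rfl | ⟨e, -⟩
    · simpa using this.trans (by simp)
    · exact hV.elim (ends e).1
  set δ : W → V →₀ ℚ := fun w => Finsupp.single (Function.invFun cl w) 1
  set F : Finset (V →₀ ℚ) := C.image (inc ends) ∪ T.image δ with hF
  have hC : incSpan ends (C : Set E) ≤ Submodule.span ℚ (F : Set (V →₀ ℚ)) := by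
    refine Submodule.span_mono ?_
    rw [hF, Finset.coe_union, Finset.coe_image]
    exact Set.subset_union_left
  have hδ : ∀ x, cl x ∈ T → (Finsupp.single x 1 : V →₀ ℚ) ∈
      Submodule.span ℚ (F : Set (V →₀ ℚ)) := by
    intro x hx
    have h1 : diff x (Function.invFun cl (cl x)) ∈ Submodule.span ℚ (F : Set (V →₀ ℚ)) :=
      hC (hcl.conn _ _ (Function.invFun_eq (f := cl) ⟨x, rfl⟩).symm)
    have h2 : δ (cl x) ∈ Submodule.span ℚ (F : Set (V →₀ ℚ)) :=
      Submodule.subset_span (Finset.mem_coe.2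
        (Finset.mem_union_right _ (Finset.mem_image_of_mem δ hx)))
    have := add_mem h1 h2
    rwa [diff, sub_add_cancel] at this
  have hle : Submodule.span ℚ (inc ends '' (A : Set E)) ≤
      Submodule.span ℚ (F : Set (V →₀ ℚ)) := by
    rw [Submodule.span_le]
    rintro _ ⟨e, he, rfl⟩
    by_cases heq : cl (ends e).1 = cl (ends e).2
    · exact hC (hcl.conn _ _ heq)
    · obtain ⟨h1, h2⟩ := hT e he heq
      exact sub_mem (hδ _ h1) (hδ _ h2)
  have := FiniteDimensional.span_of_finite ℚ F.finite_toSet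
  refine (Submodule.finrank_mono hle).trans ((finrank_span_finset_le_card F).trans ?_)
  exact (Finset.card_union_le _ _).trans (add_le_add Finset.card_image_le Finset.card_image_le)

variable [Fintype E]

/-- Elements are in series when every relation involves both or neither of them. -/
def seriesSetoid (v : E → X) (A : Finset E) : Setoid E where
  r e f := ∀ c, IsRelation v A c → (c e = 0 ↔ c f = 0)
  iseqv := ⟨fun _ _ _ => Iff.rfl, fun h c hc => (h c hc).symm,
    fun h h' c hc => (h c hc).trans (h' c hc)⟩

lemma exists_series_representatives (v : E → X) (A : Finset E) :
    ∃ P ⊆ A, (∀ e ∈ P, ∃ c, IsRelation v A c ∧ c e ≠ 0) ∧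
      (∀ e ∈ P, ∀ f ∈ P, (seriesSetoid v A).r e f → e = f) ∧
      Nat.card (Quotient (seriesSetoid v A)) ≤ P.card + 1 := by
  classical
  set s := seriesSetoid v A
  refine ⟨Finset.univ.filter fun e => (Quotient.mk s e).out = e ∧
    ∃ c, IsRelation v A c ∧ c e ≠ 0, ?_, ?_, ?_, ?_⟩
  · intro e he
    obtain ⟨-, -, c, hc, hce⟩ := Finset.mem_filter.1 he
    by_contra h
    exact hce (hc.1 e h)
  · intro e he
    exact (Finset.mem_filter.1 he).2.2
  · intro e he f hf hef
    rw [← (Finset.mem_filter.1 he).2.1, ← (Finset.mem_filter.1 hf).2.1,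
      (Quotient.sound hef : Quotient.mk s e = Quotient.mk s f)]
  · set P := Finset.univ.filter fun e => (Quotient.mk s e).out = e ∧
      ∃ c, IsRelation v A c ∧ c e ≠ 0 with hP
    have hnull : ∀ q : Quotient s, q.out ∉ P → ∀ c, IsRelation v A c → c q.out = 0 := by
      intro q hq c hc
      by_contra hce
      exact hq (Finset.mem_filter.2 ⟨Finset.mem_univ _, by rw [Quotient.out_eq], c, hc, hce⟩)
    -- The elements on which all relations vanish form at most one class; it goes to `none` and
    -- accounts for the extra one.
    let F : Quotient s → Option P := fun q => if h : q.out ∈ P then some ⟨q.out, h⟩ else none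
    have hF : Function.Injective F := by
      intro q q' h
      simp only [F] at h
      split_ifs at h with h1 h2
      · simpa using h
      · rw [← Quotient.out_eq q, ← Quotient.out_eq q']
        exact Quotient.sound fun c hc => by simp [hnull _ h1 c hc, hnull q' (by assumption) c hc]
    have := Nat.card_le_card_of_injective F hF
    simpa using this

/-- A component of the contracted graph that is touched by a representative is touched by three
of them. -/
lemma three_le_card_incident [DecidableEq E] {ends : E → V × V} {A P : Finset E} {W : Type*}
    [DecidableEq W] {cl : V → W}
    (hnull : ∀ e ∈ P, ∃ c, IsRelation (inc ends) A c ∧ c e ≠ 0)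
    (hinj : ∀ e ∈ P, ∀ f ∈ P, (seriesSetoid (inc ends) A).r e f → e = f)
    (hcl : ∀ e ∈ A \ P, cl (ends e).1 = cl (ends e).2) {w : W}
    (hw : ∃ e ∈ P, cl (ends e).1 ≠ cl (ends e).2 ∧ (cl (ends e).1 = w ∨ cl (ends e).2 = w)) :
    3 ≤ ((P.filter fun e => cl (ends e).1 ≠ cl (ends e).2).filter
      fun e => cl (ends e).1 = w ∨ cl (ends e).2 = w).card := by
  set D := (P.filter fun e => cl (ends e).1 ≠ cl (ends e).2).filter
      fun e => cl (ends e).1 = w ∨ cl (ends e).2 = w with hD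
  -- This is the cut functional of the component `w`. On `A` it is nonzero only on `D`, so every
  -- relation restricts to a scalar relation between the elements of `D`.
  set φ := sumOn {x | cl x = w}
  have hφ : ∀ e, φ (inc ends e) =
      (if cl (ends e).1 = w then 1 else 0) - (if cl (ends e).2 = w then 1 else 0) := by
    intro e
    simp only [φ, inc, sumOn_diff, Set.indicator_apply, Set.mem_ofPred_eq, Pi.one_apply]
  have hφD : ∀ e ∈ D, φ (inc ends e) ≠ 0 := by
    intro e he
    simp only [hD, Finset.mem_filter] at he
    rw [hφ]
    obtain ⟨⟨-, hne⟩, h | h⟩ := he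
    · rw [if_pos h, if_neg fun h' => hne (h.trans h'.symm)]
      norm_num
    · rw [if_pos h, if_neg fun h' => hne (h'.trans h.symm)]
      norm_num
  have hφ0 : ∀ e ∈ A, e ∉ D → φ (inc ends e) = 0 := by
    intro e he heD
    rw [hφ]
    by_cases heq : cl (ends e).1 = cl (ends e).2
    · rw [heq, sub_self]
    · have heP : e ∈ P := by
        by_contra heP
        exact heq (hcl e (Finset.mem_sdiff.2 ⟨he, heP⟩))
      simp only [hD, Finset.mem_filter, not_and, not_or] at heD
      have := heD ⟨heP, heq⟩
      rw [if_neg this.1, if_neg this.2, sub_self]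
  have hDP : ∀ e ∈ D, e ∈ P := fun e he => by
    simp only [hD, Finset.mem_filter] at he
    exact he.1.1
  have hrel : ∀ c, IsRelation (inc ends) A c → ∑ e ∈ D, c e * φ (inc ends e) = 0 := by
    intro c hc
    have := congrArg φ hc.2
    rw [map_sum, map_zero] at this
    rw [← this]
    simp only [map_smul, smul_eq_mul]
    refine Finset.sum_subset (Finset.subset_univ _) fun e _ he => ?_
    by_cases heA : e ∈ A
    · rw [hφ0 e heA he, mul_zero]
    · rw [hc.1 e heA, zero_mul]
  -- A single element of `D` would have coefficient zero in all relations; two elements would be in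
  -- series. Both contradict the choice of `P`.
  by_contra hlt
  have hpos : 0 < D.card := by
    obtain ⟨e, he, h1, h2⟩ := hw
    exact Finset.card_pos.2 ⟨e, by simp only [hD, Finset.mem_filter]; exact ⟨⟨he, h1⟩, h2⟩⟩
  obtain h1 | h2 : D.card = 1 ∨ D.card = 2 := by omega
  · obtain ⟨e, he⟩ := Finset.card_eq_one.1 h1
    have heD : e ∈ D := by simp [he]
    obtain ⟨c, hc, hce⟩ := hnull e (hDP e heD)
    have := hrel c hc
    rw [he, Finset.sum_singleton] at this
    exact mul_ne_zero hce (hφD e heD) this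
  · obtain ⟨e, f, hef, he⟩ := Finset.card_eq_two.1 h2
    have heD : e ∈ D := by simp [he]
    have hfD : f ∈ D := by simp [he]
    refine hef (hinj e (hDP e heD) f (hDP f hfD) fun c hc => ?_)
    have := hrel c hc
    rw [he, Finset.sum_pair hef] at this
    constructor
    · intro h0
      rw [h0, zero_mul, zero_add] at this
      exact (mul_eq_zero.1 this).resolve_right (hφD f hfD)
    · intro h0
      rw [h0, zero_mul, add_zero] at this
      exact (mul_eq_zero.1 this).resolve_right (hφD e heD)

/-- Contract `A \ P` and let `T` be the set of components met by the non-loops `N` of `P`. Then the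
rank is at most `|A \ P| + |T|`, so the nullity is at least `|P| - |T|`; and `3|T| ≤ 2|N| ≤ 2|P|` by
the degree bound. Hence `|P|` is at most three times the nullity. -/
lemma card_quotient_series_le (ends : E → V × V) (A : Finset E) :
    Nat.card (Quotient (seriesSetoid (inc ends) A)) ≤ 3 * nullity (inc ends) A + 1 := by
  classical
  obtain ⟨P, hPA, hnull, hinj, hcard⟩ := exists_series_representatives (inc ends) A
  have hcl := isLabelling_mk ends ((A \ P : Finset E) : Set E)
  set cl := Quotient.mk (connSetoid ends ((A \ P : Finset E) : Set E))
  set N := P.filter fun e => cl (ends e).1 ≠ cl (ends e).2 with hN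
  have hedge : ∀ e ∈ A \ P, cl (ends e).1 = cl (ends e).2 := fun e he => hcl.edge e he
  have h1 : 3 * (N.image (fun e => cl (ends e).1) ∪ N.image fun e => cl (ends e).2).card ≤
      2 * N.card := by
    refine three_mul_card_le_of_degree N _ _ fun w hw => ?_
    refine three_le_card_incident hnull hinj hedge ?_
    rw [Finset.mem_union, Finset.mem_image, Finset.mem_image] at hw
    obtain ⟨e, he, h⟩ | ⟨e, he, h⟩ := hw
    · exact ⟨e, (Finset.mem_filter.1 he).1, (Finset.mem_filter.1 he).2, Or.inl h⟩
    · exact ⟨e, (Finset.mem_filter.1 he).1, (Finset.mem_filter.1 he).2, Or.inr h⟩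
  have h2 := rank_le_card_add_card (A := A) hcl
    (T := N.image (fun e => cl (ends e).1) ∪ N.image fun e => cl (ends e).2) fun e he hne => by
      have heN : e ∈ N := by
        refine Finset.mem_filter.2 ⟨?_, hne⟩
        by_contra heP
        exact hne (hedge e (Finset.mem_sdiff.2 ⟨he, heP⟩))
      exact ⟨Finset.mem_union_left _ (Finset.mem_image_of_mem _ heN),
        Finset.mem_union_right _ (Finset.mem_image_of_mem _ heN)⟩
  have h3 := Finset.card_sdiff_add_card_eq_card hPA
  have h4 : N.card ≤ P.card := Finset.card_filter_le _ _
  rw [nullity]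
  omega

end Series

end SimFES

/-! ### Simultaneous feedback edge sets, abstractly -/

namespace SimFES

section Solvable

variable {E F V W ι : Type*}

/-- Some set of at most `k` edges leaves all the edge sets `A i` acyclic. -/
def Solvable (ends : E → V × V) (A : ι → Set E) (k : ℕ) : Prop :=
  ∃ S : Finset E, (∀ i, LinearIndepOn ℚ (inc ends) (A i \ S)) ∧ S.card ≤ k

lemma solvable_map_iff (ends : E → V × V) (A : ι → Set E) (k : ℕ) {f : V → W}
    (hf : Function.Injective f) :
    Solvable (fun e => (f (ends e).1, f (ends e).2)) A k ↔ Solvable ends A k := by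
  refine exists_congr fun S => and_congr_left fun _ => forall_congr' fun i => ?_
  have := (isLabelling_empty ends hf).linearIndepOn_union_iff (linearIndepOn_empty _ _)
    (Set.empty_disjoint (A i \ S))
  rw [Set.empty_union] at this
  exact this.symm

lemma solvable_equiv_iff (ends : F → V × V) (A : ι → Set F) (k : ℕ) (σ : E ≃ F) :
    Solvable (fun e => ends (σ e)) (fun i => σ ⁻¹' A i) k ↔ Solvable ends A k := by
  have key : ∀ (i : ι) (S : Finset E),
      LinearIndepOn ℚ (inc fun e => ends (σ e)) (σ ⁻¹' A i \ S) ↔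
        LinearIndepOn ℚ (inc ends) (A i \ (S.map σ.toEmbedding : Finset F)) := by
    intro i S
    have h := linearIndepOn_equiv (R := ℚ) σ (f := inc ends) (s := σ ⁻¹' A i \ S)
    have himg : σ '' (σ ⁻¹' A i \ S) = A i \ (S.map σ.toEmbedding : Finset F) := by
      rw [Set.image_sdiff σ.injective, Set.image_preimage_eq _ σ.surjective, Finset.coe_map]
      rfl
    rw [himg] at h
    exact h
  constructor
  · rintro ⟨S, hS, hk⟩
    exact ⟨S.map σ.toEmbedding, fun i => (key i S).1 (hS i), by rwa [Finset.card_map]⟩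
  · rintro ⟨S, hS, hk⟩
    refine ⟨S.map σ.symm.toEmbedding, fun i => (key i _).2 ?_, by rwa [Finset.card_map]⟩
    have : (S.map σ.symm.toEmbedding).map σ.toEmbedding = S := by
      ext x
      simp
    rw [this]
    exact hS i

lemma linearIndepOn_image_iff {X : Type*} [AddCommGroup X] [Module ℚ X] {v : F → X} {f : E → F}
    (hf : Function.Injective f) {s : Set E} :
    LinearIndepOn ℚ v (f '' s) ↔ LinearIndepOn ℚ (v ∘ f) s :=
  ⟨fun h => h.comp_of_image hf.injOn, fun h => h.image_of_comp _ _⟩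

/-- The functional of `b` annihilates all other vectors, so `b` has coefficient zero in every
relation; what remains is a relation on `s`. This is how coloops are added. -/
lemma linearIndepOn_union_of_functional {X : Type*} [AddCommGroup X] [Module ℚ X] {v : E → X}
    {s t : Set E} (hs : LinearIndepOn ℚ v s)
    (ht : ∀ b ∈ t, ∃ φ : X →ₗ[ℚ] ℚ, φ (v b) ≠ 0 ∧ ∀ a ∈ s ∪ t, a ≠ b → φ (v a) = 0) :
    LinearIndepOn ℚ v (s ∪ t) := by
  classical
  rw [linearIndepOn_iff''] at hs ⊢
  intro u g hu hg hsum
  have h0 : ∀ b ∈ t, g b = 0 := by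
    intro b hb
    by_contra hgb
    have hbu : b ∈ u := by
      by_contra hbu
      exact hgb (hg b hbu)
    obtain ⟨φ, hφb, hφ⟩ := ht b hb
    have := congrArg φ hsum
    rw [map_sum, map_zero, Finset.sum_eq_single_of_mem b hbu] at this
    · rw [map_smul, smul_eq_mul] at this
      exact mul_ne_zero hgb hφb this
    · intro a ha hab
      rw [map_smul, hφ a (hu ha) hab, smul_zero]
  intro i hi
  by_cases hit : i ∈ t
  · exact h0 i hit
  · refine hs (u.filter (· ∉ t)) g ?_ ?_ ?_ i (Finset.mem_filter.2 ⟨hi, hit⟩)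
    · intro x hx
      obtain ⟨h1, h2⟩ := Finset.mem_filter.1 hx
      exact (hu h1).resolve_right h2
    · intro x hx
      by_cases hxt : x ∈ t
      · exact h0 x hxt
      · exact hg x fun hxu => hx (Finset.mem_filter.2 ⟨hxu, hxt⟩)
    · rw [← hsum]
      refine Finset.sum_subset (Finset.filter_subset _ _) fun x hxu hx => ?_
      have hxt : x ∈ t := by
        by_contra hxt
        exact hx (Finset.mem_filter.2 ⟨hxu, hxt⟩)
      rw [h0 x hxt, zero_smul]

/-! ### The two cases decided by the nullities alone. -/

section Nullity

variable [Fintype ι] (ends : E → V × V) (A : ι → Finset E) (k : ℕ)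

/-- Delete the complement of a basis in each colour. -/
lemma solvable_of_sum_nullity_le (h : ∑ i, nullity (inc ends) (A i) ≤ k) :
    Solvable ends (fun i => (A i : Set E)) k := by
  classical
  choose B hBA hB hcard using fun i => exists_basis (inc ends) (A i)
  refine ⟨Finset.univ.biUnion fun i => A i \ B i, fun i => (hB i).mono ?_, ?_⟩
  · rintro e ⟨heA, he⟩
    by_contra heB
    exact he (Finset.mem_biUnion.2 ⟨i, Finset.mem_univ _, Finset.mem_sdiff.2 ⟨heA, heB⟩⟩)
  · refine Finset.card_biUnion_le.trans (le_trans (Finset.sum_le_sum fun i _ => ?_) h)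
    rw [Finset.card_sdiff_of_subset (hBA i), hcard, nullity]

/-- What an acyclic deletion leaves has size at most the rank, so at least `nullity` many edges have
been removed. -/
lemma not_solvable_of_lt_nullity {ι : Type*} {A : ι → Finset E} {i : ι}
    (h : k < nullity (inc ends) (A i)) : ¬ Solvable ends (fun i => (A i : Set E)) k := by
  classical
  rintro ⟨S, hS, hk⟩
  have h1 := hS i
  rw [← Finset.coe_sdiff] at h1
  have h2 := rank_eq_card h1
  have h3 := rank_mono (inc ends) (Finset.sdiff_subset (s := A i) (t := S))
  have h4 := Finset.le_card_sdiff S (A i)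
  rw [nullity] at h
  omega

end Nullity

/-- The data of the compressed graph: the representatives `R j` of the classes of edges that are
in series in every colour, the two new vertices `src j` and `tgt j` of each of them, the old vertex
`orig p` behind every new vertex `p`, and for every colour a canonical choice `anchor i p` of a new
vertex whose old vertex is connected to that of `p` by edges that are not representatives. -/
structure Compression (ends : E → V × V) (A : ι → Finset E) {J P : Type*} (R : J → E)
    (src tgt : J → P) (orig : P → V) (anchor : ι → P → P) (owner : P → J) [Fintype E] : Prop where
  inj : Function.Injective R
  surj : ∀ e, ∃ j, ∀ i, (seriesSetoid (inc ends) (A i)).r (R j) e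
  orig_src : ∀ j, orig (src j) = (ends (R j)).1
  orig_tgt : ∀ j, orig (tgt j) = (ends (R j)).2
  owner_src : ∀ j, owner (src j) = j
  owner_tgt : ∀ j, owner (tgt j) = j
  anchor_conn : ∀ i p, diff (orig p) (orig (anchor i p)) ∈
    incSpan ends ((A i : Set E) \ Set.range R)
  anchor_eq : ∀ i p q, diff (orig p) (orig q) ∈ incSpan ends ((A i : Set E) \ Set.range R) →
    anchor i p = anchor i q

/-- The ends of the edges of the compressed graph. -/
def compEnds {J P : Type*} (src tgt : J → P) (anchor : ι → P → P) :
    J ⊕ (ι × P) → P × P :=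
  Sum.elim (fun j => (src j, tgt j)) fun x => (x.2, anchor x.1 x.2)

/-- The links of colour `i` in the compressed graph. -/
def links {J P : Type*} (anchor : ι → P → P) (i : ι) : Set (J ⊕ (ι × P)) :=
  {x | ∃ p, x = Sum.inr (i, p) ∧ anchor i p ≠ p}

/-- The edges of colour `i` in the compressed graph. -/
def compColor (A : ι → Finset E) {J P : Type*} (R : J → E) (anchor : ι → P → P) (i : ι) :
    Set (J ⊕ (ι × P)) :=
  links anchor i ∪ Sum.inl '' {j | R j ∈ A i}

/-! ### Correctness of the compression. -/

namespace Compression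

variable {ends : E → V × V} {A : ι → Finset E} {J P : Type*} {R : J → E} {src tgt : J → P}
  {orig : P → V} {anchor : ι → P → P} {owner : P → J} [Fintype E]

lemma anchor_anchor (h : Compression ends A R src tgt orig anchor owner) (i : ι) (p : P) :
    anchor i (anchor i p) = anchor i p := (h.anchor_eq i _ _ (h.anchor_conn i p)).symm

/-- A vertex `p` with a proper link is not itself an anchor, so among the edges of colour `i` it
meets only that link and the representative owning `p`. The coordinate at `p` therefore isolates the
link once this representative is gone. -/
lemma exists_functional (h : Compression ends A R src tgt orig anchor owner) (i : ι)
    {b : J ⊕ (ι × P)} (hb : b ∈ links anchor i) :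
    ∃ φ : (P →₀ ℚ) →ₗ[ℚ] ℚ, φ (inc (compEnds src tgt anchor) b) ≠ 0 ∧
      (∀ a ∈ links anchor i, a ≠ b → φ (inc (compEnds src tgt anchor) a) = 0) ∧
      ∀ j, b ≠ Sum.inr (i, src j) → b ≠ Sum.inr (i, tgt j) →
        φ (inc (compEnds src tgt anchor) (Sum.inl j)) = 0 := by
  obtain ⟨p, rfl, hp⟩ := hb
  refine ⟨sumOn {p}, ?_, ?_, ?_⟩
  · simp [inc, compEnds, sumOn_diff, hp]
  · rintro _ ⟨q, rfl, hq⟩ hne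
    have h1 : q ≠ p := fun h' => hne (by rw [h'])
    have h2 : anchor i q ≠ p := by
      intro h'
      have := h.anchor_anchor i q
      rw [h'] at this
      exact hp this
    simp [inc, compEnds, sumOn_diff, h1, h2]
  · intro j h1 h2
    have h1' : src j ≠ p := fun h' => h1 (by rw [h'])
    have h2' : tgt j ≠ p := fun h' => h2 (by rw [h'])
    simp [inc, compEnds, sumOn_diff, h1', h2']

lemma linearIndepOn_links (h : Compression ends A R src tgt orig anchor owner) (i : ι) :
    LinearIndepOn ℚ (inc (compEnds src tgt anchor)) (links anchor i) := by
  rw [← Set.empty_union (links anchor i)]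
  refine linearIndepOn_union_of_functional (linearIndepOn_empty _ _) fun b hb => ?_
  obtain ⟨φ, h1, h2, -⟩ := h.exists_functional i hb
  exact ⟨φ, h1, by rwa [Set.empty_union]⟩

/-- Two new vertices are connected by links of colour `i` exactly when they share an anchor, that
is, when the old vertices behind them lie in one component of the non-representatives. Taking these
old components as labels makes the two contractions comparable. -/
lemma isLabelling_links (h : Compression ends A R src tgt orig anchor owner) (i : ι) :
    IsLabelling (compEnds src tgt anchor) (links anchor i)
      fun p => Quotient.mk (connSetoid ends ((A i : Set E) \ Set.range R)) (orig p) where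
  edge := by
    rintro _ ⟨p, rfl, -⟩
    exact Quotient.sound (h.anchor_conn i p)
  conn p q hpq := by
    have hconn : ∀ p, diff p (anchor i p) ∈
        incSpan (compEnds src tgt anchor) (links anchor i) := by
      intro p
      by_cases hp : anchor i p = p
      · rw [hp, diff_self]
        exact zero_mem _
      · exact inc_mem_incSpan (ends := compEnds src tgt anchor) (e := Sum.inr (i, p))
          ⟨p, rfl, hp⟩
    have h1 := hconn q
    rw [← h.anchor_eq i p q (Quotient.exact hpq)] at h1
    rw [← diff_add_diff p (anchor i p) q, ← neg_diff q]
    exact add_mem (hconn p) (neg_mem h1)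

/-- A relation between non-representatives vanishes at every representative, hence everywhere, as
each edge is in series with a representative. -/
lemma linearIndepOn_rest [DecidableEq E] (h : Compression ends A R src tgt orig anchor owner)
    (i : ι) : LinearIndepOn ℚ (inc ends) ((A i : Set E) \ Set.range R) := by
  classical
  have : (A i : Set E) \ Set.range R = ((A i).filter (· ∉ Set.range R) : Finset E) := by
    ext
    simp
  rw [this, linearIndepOn_iff_isRelation]
  intro c hc e
  have hcA : IsRelation (inc ends) (A i) c :=
    ⟨fun x hx => hc.1 x fun hx' => hx (Finset.mem_of_mem_filter _ hx'), hc.2⟩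
  obtain ⟨j, hj⟩ := h.surj e
  refine (hj i c hcA).1 (hc.1 _ ?_)
  simp

/-- Contract the non-representatives on one side and the links on the other. Both quotients use the
old components as vertices, and each representative has the same two ends there, so the same vectors
remain. -/
lemma linearIndepOn_union_iff (h : Compression ends A R src tgt orig anchor owner)
    (i : ι) (Y : Set J) :
    LinearIndepOn ℚ (inc ends) (((A i : Set E) \ Set.range R) ∪ R '' Y) ↔
      LinearIndepOn ℚ (inc (compEnds src tgt anchor)) (links anchor i ∪ Sum.inl '' Y) := by
  classical
  rw [(isLabelling_mk ends ((A i : Set E) \ Set.range R)).linearIndepOn_union_iff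
      (h.linearIndepOn_rest i), (h.isLabelling_links i).linearIndepOn_union_iff
      (h.linearIndepOn_links i)]
  · rw [linearIndepOn_image_iff h.inj, linearIndepOn_image_iff Sum.inl_injective]
    have : ∀ (u w : J → Quotient (connSetoid ends ((A i : Set E) \ Set.range R)) →₀ ℚ), u = w →
        (LinearIndepOn ℚ u Y ↔ LinearIndepOn ℚ w Y) := fun u w h => by rw [h]
    refine this _ _ (funext fun j => ?_)
    simp [inc, compEnds, h.orig_src, h.orig_tgt]
  · rw [Set.disjoint_left]
    rintro _ ⟨p, rfl, -⟩ ⟨j, -, hj⟩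
    exact Sum.inl_ne_inr hj
  · rw [Set.disjoint_left]
    rintro _ ⟨-, he⟩ ⟨j, -, rfl⟩
    exact he ⟨j, rfl⟩

lemma color_sdiff (h : Compression ends A R src tgt orig anchor owner) (i : ι) (T : Set J) :
    (A i : Set E) \ (R '' T) =
      ((A i : Set E) \ Set.range R) ∪ R '' {j | R j ∈ A i ∧ j ∉ T} := by
  ext e
  constructor
  · rintro ⟨he, heT⟩
    by_cases heR : e ∈ Set.range R
    · obtain ⟨j, rfl⟩ := heR
      exact Or.inr ⟨j, ⟨he, fun hj => heT ⟨j, hj, rfl⟩⟩, rfl⟩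
    · exact Or.inl ⟨he, heR⟩
  · rintro (⟨he, heR⟩ | ⟨j, ⟨hj, hjT⟩, rfl⟩)
    · exact ⟨he, fun ⟨j, _, hj⟩ => heR ⟨j, hj⟩⟩
    · exact ⟨hj, fun ⟨j', hj', he⟩ => hjT (h.inj he ▸ hj')⟩

/-- Neither translation of solutions adds edges. From the compressed graph, a deleted link is traded
for the representative owning its vertex. From the original graph, a deleted edge is traded for its
representative. -/
theorem solvable_iff (h : Compression ends A R src tgt orig anchor owner) (k : ℕ) :
    Solvable (compEnds src tgt anchor) (compColor A R anchor) k ↔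
      Solvable ends (fun i => (A i : Set E)) k := by
  classical
  constructor
  · rintro ⟨S, hS, hk⟩
    set T : Finset J := S.image (Sum.elim id fun x => owner x.2) with hT
    refine ⟨T.image R, fun i => ?_,
      Finset.card_image_le.trans (Finset.card_image_le.trans hk)⟩
    rw [Finset.coe_image, h.color_sdiff, h.linearIndepOn_union_iff]
    have hsub : ∀ j, j ∉ T → (Sum.inl j : J ⊕ (ι × P)) ∉ S := fun j hj hjS =>
      hj (Finset.mem_image.2 ⟨_, hjS, rfl⟩)
    set Y := {j | R j ∈ A i ∧ j ∉ (T : Set J)}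
    have hsplit : links anchor i ∪ Sum.inl '' Y =
        ((links anchor i ∪ Sum.inl '' Y) \ S) ∪ (links anchor i ∩ S) := by
      ext x
      constructor
      · intro hx
        by_cases hxS : x ∈ (S : Set (J ⊕ (ι × P)))
        · rcases hx with hx | ⟨j, hj, rfl⟩
          · exact Or.inr ⟨hx, hxS⟩
          · exact absurd hxS (hsub j hj.2)
        · exact Or.inl ⟨hx, hxS⟩
      · rintro (hx | hx)
        · exact hx.1
        · exact Or.inl hx.1
    rw [hsplit]
    -- The links in `S` are put back: the representative at each of them has been deleted, so
    -- `exists_functional` isolates it.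
    refine linearIndepOn_union_of_functional ((hS i).mono ?_) ?_
    · rintro x ⟨hx | ⟨j, hj, rfl⟩, hxS⟩
      · exact ⟨Or.inl hx, hxS⟩
      · exact ⟨Or.inr ⟨j, hj.1, rfl⟩, hxS⟩
    · rw [← hsplit]
      rintro b ⟨hb, hbS⟩
      obtain ⟨φ, h1, h2, h3⟩ := h.exists_functional i hb
      refine ⟨φ, h1, ?_⟩
      rintro _ (ha | ⟨j, hj, rfl⟩) hab
      · exact h2 _ ha hab
      · refine h3 j ?_ ?_
        · rintro rfl
          exact hj.2 (Finset.mem_coe.2 (Finset.mem_image.2 ⟨_, hbS, h.owner_src j⟩))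
        · rintro rfl
          exact hj.2 (Finset.mem_coe.2 (Finset.mem_image.2 ⟨_, hbS, h.owner_tgt j⟩))
  · rintro ⟨S, hS, hk⟩
    choose rep hrep using h.surj
    refine ⟨(S.image rep).map Function.Embedding.inl, fun i => ?_,
      (Finset.card_map _).trans_le (Finset.card_image_le.trans hk)⟩
    have hset : compColor A R anchor i \ ((S.image rep).map Function.Embedding.inl : Finset (J ⊕ (ι × P))) =
        links anchor i ∪ Sum.inl '' {j | R j ∈ A i ∧ j ∉ (S.image rep : Set J)} := by
      ext x
      constructor
      · rintro ⟨hx | ⟨j, hj, rfl⟩, hxS⟩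
        · exact Or.inl hx
        · exact Or.inr ⟨j, ⟨hj, fun hjS => hxS (by simpa using hjS)⟩, rfl⟩
      · rintro (hx | ⟨j, ⟨hj, hjS⟩, rfl⟩)
        · refine ⟨Or.inl hx, ?_⟩
          obtain ⟨p, rfl, -⟩ := hx
          simp
        · exact ⟨Or.inr ⟨j, hj, rfl⟩, by simpa using hjS⟩
    rw [hset, ← h.linearIndepOn_union_iff, ← h.color_sdiff]
    have hfin : ∀ U : Set E, ∃ B : Finset E, (B : Set E) = (A i : Set E) \ U := fun U =>
      ⟨(A i).filter (· ∉ U), by ext; simp⟩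
    have hSi := hS i
    obtain ⟨B, hB⟩ := hfin S
    obtain ⟨D, hD⟩ := hfin (R '' (S.image rep : Finset J))
    rw [← hB, linearIndepOn_iff_isRelation] at hSi
    rw [← hD, linearIndepOn_iff_isRelation]
    simp only [Set.ext_iff, Finset.mem_coe] at hB hD
    intro c hc
    have hcA : IsRelation (inc ends) (A i) c :=
      ⟨fun x hx => hc.1 x fun hx' => hx ((hD x).1 hx').1, hc.2⟩
    -- A relation avoiding the representatives of `S` vanishes on all of `S`, by series, so it is a
    -- relation on the edges left by the original solution.
    refine hSi c ⟨fun e he => ?_, hc.2⟩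
    by_cases heA : e ∈ A i
    · have heS : e ∈ S := by
        by_contra heS
        exact he ((hB e).2 ⟨heA, heS⟩)
      refine (hrep e i c hcA).1 (hc.1 _ fun h' => ((hD _).1 h').2 ?_)
      exact ⟨rep e, Finset.mem_coe.2 (Finset.mem_image_of_mem rep heS), rfl⟩
    · exact hcA.1 e heA

end Compression

end Solvable

end SimFES

/-! ### The kernel -/

namespace SimFES

namespace Instance

variable (I : Instance)

/-- The ends of an edge, as natural numbers. -/
def natEnds (e : Fin I.numEdges) : ℕ × ℕ := ((I.ends e).1, (I.ends e).2)

/-- The edges whose colour set contains `i`. -/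
def colorEdges (i : Fin I.numColors) : Finset (Fin I.numEdges) :=
  Finset.univ.filter fun e => i ∈ I.col e

/-- The cyclomatic number of the graph of colour `i`. -/
noncomputable def colorNullity (i : Fin I.numColors) : ℕ :=
  nullity (inc I.natEnds) (I.colorEdges i)

lemma noCycle_iff (A : Set (Fin I.numEdges)) (S : Finset (Fin I.numEdges)) :
    ((I.graph.restrict A).deleteEdges (S : Set (Fin I.numEdges))).NoCycle ↔
      LinearIndepOn ℚ (inc I.ends) (A \ S) := by
  have h : ∀ e x y, ((I.graph.restrict A).deleteEdges (S : Set (Fin I.numEdges))).IsLink e x y ↔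
      (I.ends e = (x, y) ∨ I.ends e = (y, x)) ∧ e ∈ A \ (S : Set (Fin I.numEdges)) := by
    intro e x y
    simp only [Graph.deleteEdges_isLink, Graph.restrict_isLink]
    simp only [graph, Set.mem_sdiff]
    tauto
  exact ⟨linearIndepOn_of_noCycle h, noCycle_of_linearIndepOn h⟩

lemma isYes_iff : I.IsYes ↔ Solvable I.ends (fun i => {e | i ∈ I.col e}) I.budget :=
  exists_congr fun _ => and_congr_left fun _ => forall_congr' fun _ => I.noCycle_iff _ _

lemma isYes_iff_natEnds :
    I.IsYes ↔ Solvable I.natEnds (fun i => (I.colorEdges i : Set (Fin I.numEdges))) I.budget := by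
  rw [isYes_iff, ← solvable_map_iff I.ends _ _ Fin.val_injective]
  simp only [colorEdges, Finset.coe_filter, Finset.mem_univ, true_and]
  rfl

open Classical in
/-- The instance with a given list of edges. -/
noncomputable def ofEdges (α k n : ℕ) {F : Type*} (es : List F) (ends : F → Fin n × Fin n)
    (A : Fin α → Set F) : Instance where
  numColors := α
  budget := k
  numVertices := n
  numEdges := es.length
  ends e := ends (es.get e)
  col e := Finset.univ.filter fun i => es.get e ∈ A i

open Classical in
lemma mem_col_ofEdges (α k n : ℕ) {F : Type*} (es : List F) (ends : F → Fin n × Fin n)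
    (A : Fin α → Set F) (e : Fin es.length) (i : Fin α) :
    i ∈ (ofEdges α k n es ends A).col e ↔ es.get e ∈ A i :=
  Finset.mem_filter.trans (and_iff_right (Finset.mem_univ _))

lemma isYes_ofEdges {α k n : ℕ} {F : Type*} {es : List F} (hnd : es.Nodup) (hes : ∀ x, x ∈ es)
    (ends : F → Fin n × Fin n) (A : Fin α → Set F) :
    (ofEdges α k n es ends A).IsYes ↔ Solvable ends A k := by
  classical
  rw [isYes_iff, ← solvable_equiv_iff ends A k (hnd.getEquivOfForallMemList es hes)]
  have : (fun i => {e | i ∈ (ofEdges α k n es ends A).col e}) = fun i =>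
      hnd.getEquivOfForallMemList es hes ⁻¹' A i :=
    funext fun i => Set.ext fun e => mem_col_ofEdges α k n es ends A e i
  rw [this]
  rfl

open Classical in
lemma encode_ofEdges (α k n : ℕ) {F : Type*} (es : List F) (ends : F → Fin n × Fin n)
    (A : Fin α → Set F) :
    (ofEdges α k n es ends A).encode = [α, k, n, es.length] ++ List.range n ++
      es.flatMap fun x => [((ends x).1 : ℕ), ((ends x).2 : ℕ)] ++
        (List.finRange α).map fun i => if x ∈ A i then 1 else 0 := by
  have h : ∀ f : F → List ℕ,
      (List.finRange es.length).flatMap (fun e => f (es.get e)) = es.flatMap f := by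
    intro f
    conv_rhs => rw [← List.map_get_finRange es, List.flatMap_map]
  rw [← h, encode]
  congr 1
  refine List.flatMap_congr fun e _ => ?_
  congr 1
  exact List.map_congr_left fun i _ => if_congr (mem_col_ofEdges α k n es ends A e i) rfl rfl

lemma length_encode :
    I.encode.length = 4 + I.numVertices + I.numEdges * (2 + I.numColors) := by
  simp [encode]
  ring

/-- Number of entries times the largest entry plus one, with the binary length of a number bounded
crudely by the number itself. Any computable bound suffices for the size of the kernel. -/
lemma bitLength_encode_le : RAM.bitLength I.encode ≤
    (4 + I.numVertices + I.numEdges * (2 + I.numColors)) *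
      (I.numColors + I.budget + I.numVertices + I.numEdges + 2) := by
  have hle : ∀ x ∈ I.encode, x ≤ I.numColors + I.budget + I.numVertices + I.numEdges + 1 := by
    intro x hx
    simp only [encode, List.mem_append, List.mem_cons, List.mem_flatMap, List.mem_map,
      List.mem_range, List.not_mem_nil, or_false] at hx
    obtain (hx | hx) | ⟨e, -, hx | ⟨i, -, hx⟩⟩ := hx
    · omega
    · omega
    · have := (I.ends e).1.2
      have := (I.ends e).2.2
      omega
    · split_ifs at hx <;> omega
  rw [← length_encode, RAM.bitLength]
  have := List.sum_le_card_nsmul (I.encode.map fun x => Nat.size x + 1)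
    (I.numColors + I.budget + I.numVertices + I.numEdges + 2) fun y hy => by
      obtain ⟨x, hx, rfl⟩ := List.mem_map.1 hy
      have h1 := hle x hx
      have h2 : Nat.size x ≤ x := Nat.size_le.2 Nat.lt_two_pow_self
      omega
  rwa [List.length_map, smul_eq_mul] at this

/-! ### Representatives of the common series classes. -/

/-- Two edges are in series in every colour. -/
def Same (e f : Fin I.numEdges) : Prop :=
  ∀ i, (seriesSetoid (inc I.natEnds) (I.colorEdges i)).r e f

/-- An edge is a representative if it is the first one of its class. -/
def IsRep (e : Fin I.numEdges) : Prop := ∀ f < e, ¬ I.Same f e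

variable {I} in
lemma Same.symm {e f : Fin I.numEdges} (h : I.Same e f) : I.Same f e :=
  fun i => (seriesSetoid (inc I.natEnds) (I.colorEdges i)).symm (h i)

variable {I} in
lemma Same.trans {e f g : Fin I.numEdges} (h : I.Same e f) (h' : I.Same f g) : I.Same e g :=
  fun i => (seriesSetoid (inc I.natEnds) (I.colorEdges i)).trans (h i) (h' i)

lemma exists_isRep_same (e : Fin I.numEdges) : ∃ f, I.IsRep f ∧ I.Same f e := by
  induction e using WellFoundedLT.induction with
  | _ e ih =>
    by_cases h : I.IsRep e
    · exact ⟨e, h, fun i => (seriesSetoid (inc I.natEnds) (I.colorEdges i)).refl e⟩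
    · rw [IsRep] at h
      push Not at h
      obtain ⟨f, hf, hfe⟩ := h
      obtain ⟨g, hg, hgf⟩ := ih f hf
      exact ⟨g, hg, hgf.trans hfe⟩

variable {I} in
lemma IsRep.eq_of_same {e f : Fin I.numEdges} (he : I.IsRep e) (hf : I.IsRep f)
    (h : I.Same e f) : e = f := by
  rcases lt_trichotomy e f with hlt | rfl | hlt
  · exact absurd h (hf e hlt)
  · rfl
  · exact absurd h.symm (he f hlt)

open Classical in
/-- The list of the representatives. -/
noncomputable def reps : List (Fin I.numEdges) := (List.finRange I.numEdges).filter I.IsRep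

lemma mem_reps {e : Fin I.numEdges} : e ∈ I.reps ↔ I.IsRep e := by simp [reps]

lemma nodup_reps : I.reps.Nodup := (List.nodup_finRange _).filter _

/-- The number of representatives. -/
noncomputable def numReps : ℕ := I.reps.length

/-- The `j`-th representative. -/
noncomputable def repEdge (j : Fin I.numReps) : Fin I.numEdges := I.reps.get j

lemma isRep_repEdge (j : Fin I.numReps) : I.IsRep (I.repEdge j) :=
  I.mem_reps.1 (List.get_mem _ _)

lemma repEdge_injective : Function.Injective I.repEdge :=
  List.nodup_iff_injective_get.1 I.nodup_reps

lemma range_repEdge : Set.range I.repEdge = {e | I.IsRep e} := by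
  ext e
  constructor
  · rintro ⟨j, rfl⟩
    exact I.isRep_repEdge j
  · intro he
    obtain ⟨j, hj⟩ := List.get_of_mem (I.mem_reps.2 he)
    exact ⟨j, hj⟩

/-- A representative is determined by the tuple of its series classes, one for each colour. -/
lemma numReps_le {b : ℕ} (h : ∀ i, I.colorNullity i ≤ b) :
    I.numReps ≤ (3 * b + 1) ^ I.numColors := by
  let f : Fin I.numReps → ∀ i, Quotient (seriesSetoid (inc I.natEnds) (I.colorEdges i)) :=
    fun j i => Quotient.mk _ (I.repEdge j)
  have hf : Function.Injective f := fun j j' hjj' =>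
    I.repEdge_injective ((I.isRep_repEdge j).eq_of_same (I.isRep_repEdge j')
      fun i => Quotient.exact (congrFun hjj' i))
  have h1 := Nat.card_le_card_of_injective f hf
  rw [Nat.card_pi, Nat.card_eq_fintype_card, Fintype.card_fin] at h1
  refine h1.trans ((Finset.prod_le_prod' fun i _ => (card_quotient_series_le _ _).trans
    (Nat.add_le_add_right (Nat.mul_le_mul_left 3 (h i)) 1)).trans ?_)
  simp

/-! ### The compressed graph of an instance. -/

/-- The representative behind a new vertex. -/
def owner (p : Fin (2 * I.numReps)) : Fin I.numReps := ⟨p / 2, by omega⟩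

/-- The first end of the `j`-th new edge. -/
def src (j : Fin I.numReps) : Fin (2 * I.numReps) := ⟨2 * j, by omega⟩

/-- The second end of the `j`-th new edge. -/
def tgt (j : Fin I.numReps) : Fin (2 * I.numReps) := ⟨2 * j + 1, by omega⟩

/-- The old vertex behind a new vertex. -/
noncomputable def orig (p : Fin (2 * I.numReps)) : ℕ :=
  if (p : ℕ) % 2 = 0 then (I.natEnds (I.repEdge (I.owner p))).1
  else (I.natEnds (I.repEdge (I.owner p))).2

/-- The edges of colour `i` that are not representatives. -/
def rest (i : Fin I.numColors) : Set (Fin I.numEdges) := {e | e ∈ I.colorEdges i ∧ ¬ I.IsRep e}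

/-- The old vertices behind two new vertices are connected by edges of colour `i` that are not
representatives. -/
def Joined (i : Fin I.numColors) (p q : Fin (2 * I.numReps)) : Prop :=
  diff (I.orig p) (I.orig q) ∈ incSpan I.natEnds (I.rest i)

lemma joined_self (i : Fin I.numColors) (p : Fin (2 * I.numReps)) : I.Joined i p p := by
  rw [Joined, diff_self]
  exact zero_mem _

variable {I} in
lemma Joined.symm {i : Fin I.numColors} {p q : Fin (2 * I.numReps)} (h : I.Joined i p q) :
    I.Joined i q p := by
  rw [Joined, ← neg_diff]
  exact neg_mem h

variable {I} in
lemma Joined.trans {i : Fin I.numColors} {p q s : Fin (2 * I.numReps)} (h : I.Joined i p q)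
    (h' : I.Joined i q s) : I.Joined i p s := by
  rw [Joined, ← diff_add_diff _ (I.orig q)]
  exact add_mem h h'

open Classical in
/-- The first new vertex joined to a given one. -/
noncomputable def anchor (i : Fin I.numColors) (p : Fin (2 * I.numReps)) : Fin (2 * I.numReps) :=
  (Finset.univ.filter fun q => I.Joined i p q).min' ⟨p, by simpa using I.joined_self i p⟩

lemma joined_anchor (i : Fin I.numColors) (p : Fin (2 * I.numReps)) :
    I.Joined i p (I.anchor i p) := by
  classical
  have := Finset.min'_mem (Finset.univ.filter fun q => I.Joined i p q)
    ⟨p, by simpa using I.joined_self i p⟩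
  exact (Finset.mem_filter.1 this).2

lemma anchor_le {i : Fin I.numColors} {p q : Fin (2 * I.numReps)} (h : I.Joined i p q) :
    I.anchor i p ≤ q := by
  classical
  exact Finset.min'_le _ _ (Finset.mem_filter.2 ⟨Finset.mem_univ _, h⟩)

lemma compression : Compression I.natEnds I.colorEdges I.repEdge I.src I.tgt I.orig I.anchor
    I.owner := by
  have hrest : ∀ i, (I.colorEdges i : Set (Fin I.numEdges)) \ Set.range I.repEdge = I.rest i := by
    intro i
    rw [range_repEdge]
    rfl
  refine ⟨I.repEdge_injective, fun e => ?_, fun j => ?_, fun j => ?_, fun j => ?_, fun j => ?_,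
    fun i p => ?_, fun i p q => ?_⟩
  · obtain ⟨f, hf, hfe⟩ := I.exists_isRep_same e
    have : f ∈ Set.range I.repEdge := by rwa [range_repEdge]
    obtain ⟨j, rfl⟩ := this
    exact ⟨j, hfe⟩
  · have : I.owner (I.src j) = j := Fin.ext (by simp [owner, src])
    rw [orig, this, if_pos (by simp [src])]
  · have : I.owner (I.tgt j) = j := Fin.ext (by simp only [owner, tgt]; omega)
    rw [orig, this, if_neg (by simp only [tgt]; omega)]
  · exact Fin.ext (by simp [owner, src])
  · exact Fin.ext (by simp only [owner, tgt]; omega)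
  · rw [hrest]
    exact I.joined_anchor i p
  · rw [hrest]
    intro h
    exact le_antisymm (I.anchor_le (Joined.trans h (I.joined_anchor i q)))
      (I.anchor_le (Joined.trans (Joined.symm h) (I.joined_anchor i p)))

/-- The edges of the compressed graph: first the representatives, then the links. -/
noncomputable def compEdges :
    List (Fin I.numReps ⊕ (Fin I.numColors × Fin (2 * I.numReps))) :=
  (List.finRange I.numReps).map Sum.inl ++ (List.finRange I.numColors).flatMap fun i =>
    (List.finRange (2 * I.numReps)).map fun p => Sum.inr (i, p)

lemma mem_compEdges (x) : x ∈ I.compEdges := by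
  rcases x with j | ⟨i, p⟩ <;> simp [compEdges]

lemma nodup_compEdges : I.compEdges.Nodup := by
  rw [compEdges, List.nodup_append]
  refine ⟨(List.nodup_finRange _).map Sum.inl_injective, ?_, ?_⟩
  · rw [List.nodup_flatMap]
    refine ⟨fun i _ => (List.nodup_finRange _).map fun p q h => ?_, ?_⟩
    · simpa using h
    · refine (List.nodup_finRange _).imp fun {i j} hij x hx hx' => hij ?_
      simp only [List.mem_map] at hx hx'
      obtain ⟨p, -, rfl⟩ := hx
      obtain ⟨q, -, h⟩ := hx'
      simp only [Sum.inr.injEq, Prod.mk.injEq] at h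
      exact h.1.symm
  · intro a ha b hb
    simp only [List.mem_map, List.mem_flatMap] at ha hb
    obtain ⟨j, -, rfl⟩ := ha
    obtain ⟨i, -, p, -, rfl⟩ := hb
    exact Sum.inl_ne_inr

lemma length_compEdges :
    I.compEdges.length = I.numReps + I.numColors * (2 * I.numReps) := by
  simp [compEdges, List.length_flatMap]

/-- The compressed instance. -/
noncomputable def compressed : Instance :=
  ofEdges I.numColors I.budget (2 * I.numReps) I.compEdges (compEnds I.src I.tgt I.anchor)
    (compColor I.colorEdges I.repEdge I.anchor)

lemma isYes_compressed : I.compressed.IsYes ↔ I.IsYes := by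
  rw [compressed, isYes_ofEdges I.nodup_compEdges I.mem_compEdges, I.compression.solvable_iff,
    ← isYes_iff_natEnds]

/-! ### The kernel and its size. -/

/-- A yes-instance without vertices. -/
noncomputable def trivialYes (α : ℕ) : Instance :=
  ofEdges α 0 0 ([] : List Empty) Empty.elim fun _ => ∅

lemma isYes_trivialYes (α : ℕ) : (trivialYes α).IsYes := by
  rw [trivialYes, isYes_ofEdges List.nodup_nil (fun x => x.elim)]
  exact ⟨∅, fun i => by simp, le_rfl⟩

/-- A no-instance with one vertex and one edge, if there is a colour. -/
noncomputable def trivialNo (α : ℕ) : Instance :=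
  ofEdges α 0 1 [()] (fun _ => (0, 0)) fun _ => Set.univ

/-- The edge is a loop, so its incidence vector is zero, and the budget does not allow its deletion.
-/
lemma not_isYes_trivialNo {α : ℕ} (hα : 0 < α) : ¬ (trivialNo α).IsYes := by
  rw [trivialNo, isYes_ofEdges (List.nodup_singleton _) (by simp)]
  rintro ⟨S, hS, hk⟩
  rw [Nat.le_zero, Finset.card_eq_zero] at hk
  have := (hS ⟨0, hα⟩).ne_zero (i := ()) (by simp [hk])
  simp [inc] at this

open Classical in
/-- The kernelization. -/
noncomputable def kernel : Instance :=
  if ∑ i, I.colorNullity i ≤ I.budget then trivialYes I.numColors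
  else if ∃ i, I.budget < I.colorNullity i then trivialNo I.numColors
  else I.compressed

lemma isYes_kernel : I.kernel.IsYes ↔ I.IsYes := by
  rw [kernel]
  split_ifs with h1 h2
  · exact iff_of_true (isYes_trivialYes _)
      (I.isYes_iff_natEnds.2 (solvable_of_sum_nullity_le _ _ _ h1))
  · obtain ⟨i, hi⟩ := h2
    refine iff_of_false (not_isYes_trivialNo i.pos) fun h => ?_
    exact not_solvable_of_lt_nullity _ _ hi (I.isYes_iff_natEnds.1 h)
  · exact I.isYes_compressed

lemma numColors_kernel : I.kernel.numColors = I.numColors := by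
  rw [kernel]
  split_ifs <;> rfl

lemma budget_kernel_le : I.kernel.budget ≤ I.budget := by
  rw [kernel]
  split_ifs
  · exact Nat.zero_le _
  · exact Nat.zero_le _
  · exact le_rfl

lemma size_kernel_le :
    I.kernel.numVertices ≤ 2 * (3 * I.budget + 1) ^ I.numColors ∧
      I.kernel.numEdges ≤ (2 * I.numColors + 1) * (3 * I.budget + 1) ^ I.numColors := by
  have hpos : 1 ≤ (3 * I.budget + 1) ^ I.numColors := Nat.one_le_pow _ _ (Nat.succ_pos _)
  rw [kernel]
  split_ifs with h1 h2
  · exact ⟨Nat.zero_le _, Nat.zero_le _⟩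
  · refine ⟨?_, ?_⟩
    · change 1 ≤ _
      omega
    · change 1 ≤ _
      exact Nat.one_le_iff_ne_zero.2 (mul_ne_zero (Nat.succ_ne_zero _) (by omega))
  · push Not at h2
    have h := I.numReps_le h2
    refine ⟨Nat.mul_le_mul_left 2 h, ?_⟩
    change I.compEdges.length ≤ _
    rw [length_compEdges]
    calc I.numReps + I.numColors * (2 * I.numReps)
        = (2 * I.numColors + 1) * I.numReps := by ring
      _ ≤ _ := Nat.mul_le_mul_left _ h

/-- In the compressed case no nullity exceeds `k` but their sum does, which forces `k ≥ 1` and `α ≥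
2`. With `b = k * α ≥ 2` this gives `3 * k + 1 ≤ 4 * k ≤ b ^ 3` and `2 ≤ b ^ α`, hence the exponent
`4 * α`. -/
lemma numVertices_kernel_le :
    I.kernel.numVertices ≤ max 1 (I.budget * I.numColors) ^ (4 * I.numColors) := by
  rw [kernel]
  split_ifs with h1 h2
  · exact Nat.zero_le _
  · exact Nat.one_le_pow _ _ (by omega)
  · push Not at h1 h2
    have hr := I.numReps_le h2
    have hk : 1 ≤ I.budget := by
      by_contra hk
      refine absurd h1 (not_lt.2 ((Finset.sum_eq_zero fun i _ => ?_).trans_le (Nat.zero_le _)))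
      have := h2 i
      omega
    have hα : 2 ≤ I.numColors := by
      by_contra hα
      have : ∑ i, I.colorNullity i ≤ ∑ _i : Fin I.numColors, I.budget :=
        Finset.sum_le_sum fun i _ => h2 i
      rw [Finset.sum_const, Finset.card_univ, Fintype.card_fin, smul_eq_mul] at this
      have : I.numColors * I.budget ≤ 1 * I.budget := Nat.mul_le_mul_right _ (by omega)
      omega
    set k := I.budget
    set α := I.numColors
    have hb : 2 ≤ k * α := le_trans (by omega) (Nat.mul_le_mul hk hα)
    have hkb : k ≤ k * α := Nat.le_mul_of_pos_right _ (by omega)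
    rw [max_eq_right (by omega)]
    set b := k * α
    have h4 : 3 * k + 1 ≤ b ^ 3 := by
      have : 2 * 2 ≤ b * b := Nat.mul_le_mul hb hb
      have : 4 * k ≤ b * b * b := Nat.mul_le_mul this hkb
      rw [pow_succ, sq]
      omega
    have h2b : 2 ≤ b ^ α := hb.trans (Nat.le_self_pow (by omega) _)
    calc 2 * I.numReps ≤ b ^ α * (b ^ 3) ^ α :=
          Nat.mul_le_mul h2b (hr.trans (Nat.pow_le_pow_left h4 _))
      _ = b ^ (4 * α) := by
        rw [← pow_mul, ← pow_add]
        congr 1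
        ring

end Instance

/-- A bound on the size of the kernel. -/
def sizeBound (x : ℕ × ℕ) : ℕ :=
  (4 + 2 * (3 * x.1 + 1) ^ x.2 + (2 * x.2 + 1) * (3 * x.1 + 1) ^ x.2 * (2 + x.2)) *
    (x.2 + x.1 + 2 * (3 * x.1 + 1) ^ x.2 + (2 * x.2 + 1) * (3 * x.1 + 1) ^ x.2 + 2)

lemma primrec_sizeBound : Primrec sizeBound := by
  have hpow : Primrec₂ fun a b : ℕ => a ^ b := by
    refine (Primrec.nat_rec (f := fun _ : ℕ => 1) (g := fun a (x : ℕ × ℕ) => x.2 * a)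
      (Primrec.const 1) (Primrec.nat_mul.comp (Primrec.snd.comp Primrec.snd)
        Primrec.fst)).of_eq fun a b => ?_
    induction b with
    | zero => rfl
    | succ b ih => rw [pow_succ, ← ih]
  have hc : ∀ n : ℕ, Primrec fun _ : ℕ × ℕ => n := fun n => Primrec.const n
  have h1 : Primrec fun x : ℕ × ℕ => (3 * x.1 + 1) ^ x.2 :=
    hpow.comp (Primrec.nat_add.comp (Primrec.nat_mul.comp (hc 3) Primrec.fst) (hc 1)) Primrec.snd
  have h2 : Primrec fun x : ℕ × ℕ => 2 * (3 * x.1 + 1) ^ x.2 := Primrec.nat_mul.comp (hc 2) h1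
  have h3 : Primrec fun x : ℕ × ℕ => (2 * x.2 + 1) * (3 * x.1 + 1) ^ x.2 :=
    Primrec.nat_mul.comp
      (Primrec.nat_add.comp (Primrec.nat_mul.comp (hc 2) Primrec.snd) (hc 1)) h1
  exact Primrec.nat_mul.comp
    (Primrec.nat_add.comp (Primrec.nat_add.comp (hc 4) h2)
      (Primrec.nat_mul.comp h3 (Primrec.nat_add.comp (hc 2) Primrec.snd)))
    (Primrec.nat_add.comp (Primrec.nat_add.comp (Primrec.nat_add.comp
      (Primrec.nat_add.comp Primrec.snd Primrec.fst) h2) h3) (hc 2))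

lemma bitLength_kernel_le (I : Instance) :
    RAM.bitLength I.kernel.encode ≤ sizeBound I.param := by
  obtain ⟨h1, h2⟩ := I.size_kernel_le
  refine I.kernel.bitLength_encode_le.trans ?_
  rw [I.numColors_kernel, sizeBound, Instance.param]
  refine Nat.mul_le_mul ?_ ?_
  · gcongr
  · have := I.budget_kernel_le
    gcongr

end SimFES

/-! ### A program logic for the machine -/

namespace RAM

/-- Change the value of a register. -/
def State.setVar (s : State) (r v : ℕ) : State := { s with var := Function.update s.var r v }

/-- Change the value of a cell of an array. -/
def State.setArr (s : State) (a i v : ℕ) : State :=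
  { s with arr := Function.update s.arr a (Function.update (s.arr a) i v) }

/-- Append a number to the output. -/
def State.push (s : State) (v : ℕ) : State := { s with out := s.out ++ [v] }

@[simp] lemma State.var_setVar (s : State) (r v x : ℕ) :
    (s.setVar r v).var x = if x = r then v else s.var x := Function.update_apply _ _ _ _

@[simp] lemma State.arr_setVar (s : State) (r v : ℕ) : (s.setVar r v).arr = s.arr := rfl

@[simp] lemma State.out_setVar (s : State) (r v : ℕ) : (s.setVar r v).out = s.out := rfl

@[simp] lemma State.var_setArr (s : State) (a i v : ℕ) : (s.setArr a i v).var = s.var := rfl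

@[simp] lemma State.arr_setArr (s : State) (a i v b j : ℕ) :
    (s.setArr a i v).arr b j = if b = a ∧ j = i then v else s.arr b j := by
  rw [State.setArr]
  by_cases hb : b = a
  · subst hb
    simp [Function.update_apply]
  · simp [hb]

@[simp] lemma State.out_setArr (s : State) (a i v : ℕ) : (s.setArr a i v).out = s.out := rfl

@[simp] lemma State.var_push (s : State) (v : ℕ) : (s.push v).var = s.var := rfl

@[simp] lemma State.arr_push (s : State) (v : ℕ) : (s.push v).arr = s.arr := rfl

@[simp] lemma State.out_push (s : State) (v : ℕ) : (s.push v).out = s.out ++ [v] := rfl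

attribute [simp] Expr.eval

namespace Prog

/-- A bound on the number of steps if every loop is iterated at most `N` times whenever it is
entered, as a polynomial in `N`. -/
noncomputable def boundPoly : Prog → Polynomial ℕ
  | skip => 1
  | assign _ e => Polynomial.C (e.cost + 1)
  | store _ i e => Polynomial.C (i.cost + e.cost + 1)
  | write e => Polynomial.C (e.cost + 1)
  | seq p q => p.boundPoly + q.boundPoly + 1
  | ite e p q => Polynomial.C (e.cost + 1) + p.boundPoly + q.boundPoly
  | loop e p => Polynomial.C (e.cost + 1) +
      Polynomial.X * (Polynomial.C (e.cost + 1) + p.boundPoly)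

/-- The value of `boundPoly`. -/
noncomputable def bound (p : Prog) (N : ℕ) : ℕ := p.boundPoly.eval N

/-- Whether a program may change a register. -/
def modVar : Prog → ℕ → Bool
  | skip, _ => false
  | assign r _, x => r == x
  | store _ _ _, _ => false
  | write _, _ => false
  | seq p q, x => p.modVar x || q.modVar x
  | ite _ p q, x => p.modVar x || q.modVar x
  | loop _ p, x => p.modVar x

/-- Whether a program may change an array. -/
def modArr : Prog → ℕ → Bool
  | skip, _ => false
  | assign _ _, _ => false
  | store a _ _, x => a == x
  | write _, _ => false
  | seq p q, x => p.modArr x || q.modArr x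
  | ite _ p q, x => p.modArr x || q.modArr x
  | loop _ p, x => p.modArr x

/-- Whether a program may write. -/
def modOut : Prog → Bool
  | skip => false
  | assign _ _ => false
  | store _ _ _ => false
  | write _ => true
  | seq p q => p.modOut || q.modOut
  | ite _ p q => p.modOut || q.modOut
  | loop _ p => p.modOut

end Prog

/-- The two states agree on everything that the program cannot change. -/
structure Frame (p : Prog) (s s' : State) : Prop where
  var : ∀ r, p.modVar r = false → s'.var r = s.var r
  arr : ∀ a, p.modArr a = false → s'.arr a = s.arr a
  out : p.modOut = false → s'.out = s.out

lemma Frame.refl (p : Prog) (s : State) : Frame p s s :=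
  ⟨fun _ _ => rfl, fun _ _ => rfl, fun _ => rfl⟩

lemma Frame.trans {p : Prog} {s s' s'' : State} (h : Frame p s s') (h' : Frame p s' s'') :
    Frame p s s'' :=
  ⟨fun r hr => (h'.var r hr).trans (h.var r hr), fun a ha => (h'.arr a ha).trans (h.arr a ha),
    fun ho => (h'.out ho).trans (h.out ho)⟩

lemma Frame.mono {p q : Prog} {s s' : State} (h : Frame p s s')
    (hv : ∀ r, q.modVar r = false → p.modVar r = false)
    (ha : ∀ a, q.modArr a = false → p.modArr a = false)
    (ho : q.modOut = false → p.modOut = false) : Frame q s s' :=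
  ⟨fun r hr => h.var r (hv r hr), fun a h' => h.arr a (ha a h'), fun h' => h.out (ho h')⟩

/-- The tests for modified memory are Boolean functions of the program text, so later side
conditions about untouched registers and arrays hold by `rfl`. -/
lemma Exec.frame {p : Prog} {s s' : State} {t : ℕ} (h : Exec p s t s') : Frame p s s' := by
  induction h with
  | skip s => exact Frame.refl _ _
  | assign r e s =>
    refine ⟨fun x hx => ?_, fun _ _ => rfl, fun _ => rfl⟩
    have hx : x ≠ r := fun h => by simp [Prog.modVar, h] at hx
    exact Function.update_of_ne hx _ _
  | store a i e s =>
    refine ⟨fun _ _ => rfl, fun x hx => ?_, fun _ => rfl⟩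
    have hx : x ≠ a := fun h => by simp [Prog.modArr, h] at hx
    exact Function.update_of_ne hx _ _
  | write e s => exact ⟨fun _ _ => rfl, fun _ _ => rfl, fun h => by simp [Prog.modOut] at h⟩
  | seq _ _ ih ih' =>
    refine Frame.trans (ih.mono ?_ ?_ ?_) (ih'.mono ?_ ?_ ?_) <;>
      simp +contextual [Prog.modVar, Prog.modArr, Prog.modOut]
  | ite_true _ _ ih =>
    refine ih.mono ?_ ?_ ?_ <;> simp +contextual [Prog.modVar, Prog.modArr, Prog.modOut]
  | ite_false _ _ ih =>
    refine ih.mono ?_ ?_ ?_ <;> simp +contextual [Prog.modVar, Prog.modArr, Prog.modOut]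
  | loop_done _ => exact Frame.refl _ _
  | loop_step _ _ _ ih ih' => exact Frame.trans (ih.mono (by simp [Prog.modVar])
      (by simp [Prog.modArr]) (by simp [Prog.modOut])) ih'

/-- Program `p` started in `s` halts within its step bound in a state satisfying `Q`. -/
def Runs (N : ℕ) (p : Prog) (s : State) (Q : State → Prop) : Prop :=
  ∃ t s', Exec p s t s' ∧ t ≤ p.bound N ∧ Q s'

section Rules

variable {N : ℕ} {p q : Prog} {s : State} {Q Q' : State → Prop}

/-- The frame is handed to the continuation, so a specification need only mention what the program
computes. -/
lemma Runs.mono (h : Runs N p s Q) (hQ : ∀ s', Frame p s s' → Q s' → Q' s') : Runs N p s Q' := by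
  obtain ⟨t, s', he, ht, hs⟩ := h
  exact ⟨t, s', he, ht, hQ s' he.frame hs⟩

lemma runs_skip (h : Q s) : Runs N .skip s Q :=
  ⟨1, s, .skip s, by simp [Prog.bound, Prog.boundPoly], h⟩

lemma runs_assign {r : ℕ} {e : Expr} (h : Q (s.setVar r (e.eval s))) : Runs N (.assign r e) s Q :=
  ⟨_, _, .assign r e s, by simp [Prog.bound, Prog.boundPoly], h⟩

lemma runs_store {a : ℕ} {i e : Expr} (h : Q (s.setArr a (i.eval s) (e.eval s))) :
    Runs N (.store a i e) s Q :=
  ⟨_, _, .store a i e s, by simp [Prog.bound, Prog.boundPoly], h⟩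

lemma runs_write {e : Expr} (h : Q (s.push (e.eval s))) : Runs N (.write e) s Q :=
  ⟨_, _, .write e s, by simp [Prog.bound, Prog.boundPoly], h⟩

lemma Runs.seq (h : Runs N p s fun s' => Runs N q s' Q) : Runs N (.seq p q) s Q := by
  obtain ⟨t, s', he, ht, t', s'', he', ht', hs⟩ := h
  refine ⟨_, s'', .seq he he', ?_, hs⟩
  simp only [Prog.bound, Prog.boundPoly, Polynomial.eval_add, Polynomial.eval_one] at *
  omega

lemma runs_ite {e : Expr} (h : e.eval s ≠ 0 → Runs N p s Q) (h' : e.eval s = 0 → Runs N q s Q) :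
    Runs N (.ite e p q) s Q := by
  by_cases he : e.eval s = 0
  · obtain ⟨t, s', hx, ht, hs⟩ := h' he
    refine ⟨_, s', .ite_false he hx, ?_, hs⟩
    simp only [Prog.bound, Prog.boundPoly, Polynomial.eval_add, Polynomial.eval_C] at *
    omega
  · obtain ⟨t, s', hx, ht, hs⟩ := h he
    refine ⟨_, s', .ite_true he hx, ?_, hs⟩
    simp only [Prog.bound, Prog.boundPoly, Polynomial.eval_add, Polynomial.eval_C] at *
    omega

/-- The index of `Inv` counts completed iterations, and `hstep` shows that another one starts only
while it is below `B`. The induction is on a bound `d` for the iterations left, which also yields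
the step count. -/
lemma runs_loop {e : Expr} {B : ℕ} (hB : B ≤ N) (Inv : ℕ → State → Prop) (h0 : Inv 0 s)
    (hdone : ∀ j s', Frame (.loop e p) s s' → Inv j s' → e.eval s' = 0 → Q s')
    (hstep : ∀ j s', Frame (.loop e p) s s' → Inv j s' → e.eval s' ≠ 0 →
      j < B ∧ Runs N p s' (Inv (j + 1))) :
    Runs N (.loop e p) s Q := by
  have key : ∀ d j s', B - j ≤ d → Frame (.loop e p) s s' → Inv j s' →
      ∃ t s'', Exec (.loop e p) s' t s'' ∧
        t ≤ (e.cost + 1) + d * (e.cost + 1 + p.bound N) ∧ Q s'' := by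
    intro d
    induction d with
    | zero =>
      intro j s' hd hF hI
      have he : e.eval s' = 0 := by
        by_contra he
        have := (hstep j s' hF hI he).1
        omega
      exact ⟨_, s', .loop_done he, by omega, hdone j s' hF hI he⟩
    | succ d ih =>
      intro j s' hd hF hI
      by_cases he : e.eval s' = 0
      · exact ⟨_, s', .loop_done he, by omega, hdone j s' hF hI he⟩
      · obtain ⟨hj, t, s₁, hx, ht, hI'⟩ := hstep j s' hF hI he
        have hF' : Frame (.loop e p) s s₁ := hF.trans (hx.frame.mono (by simp [Prog.modVar])
          (by simp [Prog.modArr]) (by simp [Prog.modOut]))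
        obtain ⟨t', s₂, hx', ht', hQ⟩ := ih (j + 1) s₁ (by omega) hF' hI'
        refine ⟨_, s₂, .loop_step he hx hx', ?_, hQ⟩
        rw [Nat.succ_mul]
        omega
  obtain ⟨t, s', hx, ht, hQ⟩ := key B 0 s (by omega) (Frame.refl _ _) h0
  refine ⟨t, s', hx, ht.trans ?_, hQ⟩
  have := Nat.mul_le_mul_right (e.cost + 1 + p.bound N) hB
  simp only [Prog.bound, Prog.boundPoly, Polynomial.eval_add, Polynomial.eval_C,
    Polynomial.eval_mul, Polynomial.eval_X] at *
  omega

/-- Run `body` with register `r` equal to `0, …, bnd - 1`. -/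
def forLoop (r : ℕ) (bnd : Expr) (body : Prog) : Prog :=
  .seq (.assign r (.const 0))
    (.loop (.sub bnd (.var r)) (.seq body (.assign r (.add (.var r) (.const 1)))))

/-- The counter is reset and advanced outside `body`, so the invariant must not depend on register
`r`; this is `hins`. -/
lemma runs_forLoop {r : ℕ} {bnd : Expr} {body : Prog} {B : ℕ} (hB : B ≤ N)
    (Inv : ℕ → State → Prop) (hr : body.modVar r = false)
    (hbnd : ∀ s', Frame (forLoop r bnd body) s s' → bnd.eval s' = B)
    (h0 : Inv 0 s) (hins : ∀ j s' x, Inv j s' → Inv j (s'.setVar r x))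
    (hstep : ∀ j < B, ∀ s', Frame (forLoop r bnd body) s s' → s'.var r = j → Inv j s' →
      Runs N body s' (Inv (j + 1)))
    (hQ : ∀ s', Frame (forLoop r bnd body) s s' → Inv B s' → Q s') :
    Runs N (forLoop r bnd body) s Q := by
  have hF0 : Frame (forLoop r bnd body) s (s.setVar r 0) := by
    refine ⟨fun x hx => ?_, fun _ _ => rfl, fun _ => rfl⟩
    have hx : x ≠ r := fun h => by simp [forLoop, Prog.modVar, h] at hx
    simp [hx]
  have hF1 : ∀ {s'}, Frame (.loop (.sub bnd (.var r))
      (.seq body (.assign r (.add (.var r) (.const 1))))) (s.setVar r 0) s' →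
      Frame (forLoop r bnd body) s s' := fun hF =>
    hF0.trans (hF.mono (by simp +contextual [forLoop, Prog.modVar])
      (by simp [forLoop, Prog.modArr]) (by simp [forLoop, Prog.modOut]))
  refine Runs.seq (runs_assign ?_)
  refine runs_loop hB (fun j s' => s'.var r = j ∧ j ≤ B ∧ Inv j s')
    ⟨by simp, Nat.zero_le _, hins _ _ _ h0⟩ ?_ ?_
  · rintro j s' hF ⟨hj, hjB, hI⟩ he
    have hF' := hF1 hF
    rw [Expr.eval, hbnd s' hF', Expr.eval, hj] at he
    obtain rfl : j = B := by omega
    exact hQ s' hF' hI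
  · rintro j s' hF ⟨hj, hjB, hI⟩ he
    have hF' := hF1 hF
    rw [Expr.eval, hbnd s' hF', Expr.eval, hj] at he
    refine ⟨by omega, Runs.seq ((hstep j (by omega) s' hF' hj hI).mono fun s₁ hF₁ hI₁ => ?_)⟩
    refine runs_assign ⟨?_, by omega, hins _ _ _ hI₁⟩
    simp [hF₁.var r hr, hj]

lemma take_succ_finRange {B j : ℕ} (hj : j < B) :
    (List.finRange B).take (j + 1) = (List.finRange B).take j ++ [⟨j, hj⟩] := by
  rw [List.take_add_one, List.getElem?_eq_getElem (by simpa using hj)]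
  simp

/-- A loop that only writes. -/
lemma runs_forLoop_out {r : ℕ} {bnd : Expr} {body : Prog} {B : ℕ} (hB : B ≤ N)
    (g : Fin B → List ℕ) (hr : body.modVar r = false)
    (hbnd : ∀ s', Frame (forLoop r bnd body) s s' → bnd.eval s' = B)
    (hstep : ∀ j : Fin B, ∀ s', Frame (forLoop r bnd body) s s' → s'.var r = j →
      Runs N body s' fun s'' => s''.out = s'.out ++ g j)
    (hQ : ∀ s', Frame (forLoop r bnd body) s s' →
      s'.out = s.out ++ (List.finRange B).flatMap g → Q s') :
    Runs N (forLoop r bnd body) s Q := by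
  refine runs_forLoop hB (fun j s' => s'.out = s.out ++ ((List.finRange B).take j).flatMap g) hr
    hbnd (by simp) (fun _ _ _ h => h) ?_ ?_
  · intro j hj s' hF hr hI
    refine (hstep ⟨j, hj⟩ s' hF hr).mono fun s'' _ h => ?_
    rw [h, hI, take_succ_finRange hj, List.flatMap_append, List.append_assoc]
    simp
  · intro s' hF hI
    refine hQ s' hF ?_
    rwa [List.take_of_length_le (by simp)] at hI

/-- An expression that is nonzero if and only if the two given expressions differ. -/
def neq (e f : Expr) : Expr := .add (.sub e f) (.sub f e)

@[simp] lemma eval_neq (e f : Expr) (s : State) :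
    (neq e f).eval s = (e.eval s - f.eval s) + (f.eval s - e.eval s) := rfl

end Rules

end RAM

/-! ### Computing the connected components and the nullity of a set of edges -/

namespace SimFES

section Union

variable {V E : Type*} [DecidableEq V]

/-- Merging two fibres of a labelling when an edge is added. -/
lemma diff_mem_incSpan_of_merge {ends : E → V × V} {C : Set E} {e : E} {lab : V → V}
    (h : ∀ x, diff x (lab x) ∈ incSpan ends C) (x : V) :
    diff x (if lab x = lab (ends e).2 then lab (ends e).1 else lab x) ∈
      incSpan ends (insert e C) := by
  have hle : incSpan ends C ≤ incSpan ends (insert e C) := incSpan_mono (Set.subset_insert _ _)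
  have h' : ∀ x, diff x (lab x) ∈ incSpan ends (insert e C) := fun x => hle (h x)
  split_ifs with hx
  · have he : diff (ends e).1 (ends e).2 ∈ incSpan ends (insert e C) :=
      inc_mem_incSpan (Set.mem_insert _ _)
    have h1 := h' x
    rw [hx] at h1
    have h2 := neg_mem (h' (ends e).2)
    have h3 := neg_mem he
    rw [neg_diff] at h2 h3
    -- The route from `x` passes through `lab x = lab (ends e).2`, then `(ends e).2`, then `(ends
    -- e).1`, and ends at `lab (ends e).1`.
    have := add_mem (add_mem (add_mem h1 h2) h3) (h' (ends e).1)
    rwa [diff_add_diff, diff_add_diff, diff_add_diff] at this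
  · exact h' x

end Union

namespace Instance

variable (I : Instance)

/-- An array of labels of the vertices that is constant exactly on the components of `A`. -/
structure Labels (A : Set (Fin I.numEdges)) (lab : ℕ → ℕ) : Prop where
  edge : ∀ e ∈ A, lab (I.natEnds e).1 = lab (I.natEnds e).2
  conn : ∀ x < I.numVertices, diff x (lab x) ∈ incSpan I.natEnds A

variable {I}

lemma natEnds_lt (e : Fin I.numEdges) :
    (I.natEnds e).1 < I.numVertices ∧ (I.natEnds e).2 < I.numVertices :=
  ⟨(I.ends e).1.2, (I.ends e).2.2⟩

/-- The array is controlled only below `numVertices`. Elsewhere the identity serves, as no edge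
reaches those numbers. -/
lemma Labels.isLabelling {A : Set (Fin I.numEdges)} {lab : ℕ → ℕ} (h : I.Labels A lab) :
    IsLabelling I.natEnds A fun x => if x < I.numVertices then lab x else x where
  edge e he := by
    rw [if_pos (natEnds_lt e).1, if_pos (natEnds_lt e).2, h.edge e he]
  conn x y hxy := by
    have h' : ∀ x, diff x (if x < I.numVertices then lab x else x) ∈ incSpan I.natEnds A := by
      intro x
      split_ifs with hx
      · exact h.conn x hx
      · rw [diff_self]
        exact zero_mem _
    have h1 := neg_mem (h' y)
    rw [neg_diff, ← hxy] at h1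
    have := add_mem (h' x) h1
    rwa [diff_add_diff] at this

lemma Labels.eq_iff {A : Set (Fin I.numEdges)} {lab : ℕ → ℕ} (h : I.Labels A lab) {x y : ℕ}
    (hx : x < I.numVertices) (hy : y < I.numVertices) :
    lab x = lab y ↔ diff x y ∈ incSpan I.natEnds A := by
  have := h.isLabelling.eq_iff x y
  rwa [if_pos hx, if_pos hy] at this

lemma labels_id : I.Labels ∅ id where
  edge := by simp
  conn x _ := by rw [id, diff_self]; exact zero_mem _

lemma Labels.congr {A : Set (Fin I.numEdges)} {lab lab' : ℕ → ℕ} (h : I.Labels A lab)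
    (hl : ∀ x < I.numVertices, lab' x = lab x) : I.Labels A lab' where
  edge e he := by rw [hl _ (natEnds_lt e).1, hl _ (natEnds_lt e).2, h.edge e he]
  conn x hx := by rw [hl x hx]; exact h.conn x hx

lemma Labels.insert_of_eq {A : Set (Fin I.numEdges)} {lab : ℕ → ℕ} (h : I.Labels A lab)
    {e : Fin I.numEdges} (he : lab (I.natEnds e).1 = lab (I.natEnds e).2) :
    I.Labels (insert e A) lab where
  edge f hf := by
    rcases hf with rfl | hf
    · exact he
    · exact h.edge f hf
  conn x hx := incSpan_mono (Set.subset_insert _ _) (h.conn x hx)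

lemma Labels.insert_merge {A : Set (Fin I.numEdges)} {lab : ℕ → ℕ} (h : I.Labels A lab)
    (e : Fin I.numEdges) : I.Labels (insert e A) fun x =>
      if lab x = lab (I.natEnds e).2 then lab (I.natEnds e).1 else lab x where
  edge f hf := by
    rcases hf with rfl | hf
    · simp
    · simp only [h.edge f hf]
  conn x hx := by
    have := diff_mem_incSpan_of_merge (e := e) (C := A)
      (lab := fun x => if x < I.numVertices then lab x else x) (ends := I.natEnds) (fun x => by
        split_ifs with hx
        · exact h.conn x hx
        · rw [diff_self]
          exact zero_mem _) x
    simpa only [if_pos hx, if_pos (natEnds_lt e).1, if_pos (natEnds_lt e).2] using this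

end Instance

end SimFES

namespace RAM

open SimFES SimFES.Instance

/-- What the memory of the machine knows about an instance once the input has been read. -/
structure Knows (I : Instance) (s : State) : Prop where
  colors : s.var 1 = I.numColors
  budget : s.var 2 = I.budget
  vertices : s.var 3 = I.numVertices
  edges : s.var 4 = I.numEdges
  fst : ∀ e : Fin I.numEdges, s.arr 0 (s.arr 1 e) = (I.natEnds e).1
  snd : ∀ e : Fin I.numEdges, s.arr 0 (s.arr 1 e + 1) = (I.natEnds e).2
  col : ∀ (e : Fin I.numEdges) (i : Fin I.numColors),
    s.arr 0 (s.arr 1 e + (2 + i)) = if i ∈ I.col e then 1 else 0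

/-- The program does not change the registers and arrays that describe the instance. -/
def KeepsInput (p : Prog) : Prop :=
  p.modVar 1 = false ∧ p.modVar 2 = false ∧ p.modVar 3 = false ∧ p.modVar 4 = false ∧
    p.modArr 0 = false ∧ p.modArr 1 = false

lemma Knows.frame {I : Instance} {p : Prog} {s s' : State} (h : Knows I s) (hF : Frame p s s')
    (hp : KeepsInput p) : Knows I s' := by
  obtain ⟨h1, h2, h3, h4, h5, h6⟩ := hp
  have a0 := hF.arr 0 h5
  have a1 := hF.arr 1 h6
  exact ⟨(hF.var 1 h1).trans h.colors, (hF.var 2 h2).trans h.budget,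
    (hF.var 3 h3).trans h.vertices, (hF.var 4 h4).trans h.edges,
    by simpa only [a0, a1] using h.fst, by simpa only [a0, a1] using h.snd,
    by simpa only [a0, a1] using h.col⟩

/-- The first end of an edge. -/
def fstE (e : Expr) : Expr := .arr 0 (.arr 1 e)

/-- The second end of an edge. -/
def sndE (e : Expr) : Expr := .arr 0 (.add (.arr 1 e) (.const 1))

/-- Whether an edge has a colour. -/
def colE (e i : Expr) : Expr := .arr 0 (.add (.arr 1 e) (.add (.const 2) i))

/-- Replace the label in register `9` by the label in register `8`. -/
def relabelProg : Prog :=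
  forLoop 7 (.var 3) (.ite (neq (.arr 2 (.var 7)) (.var 9)) .skip (.store 2 (.var 7) (.var 8)))

/-- Add the edge in register `6`. -/
def addEdgeProg : Prog :=
  .seq (.assign 8 (.arr 2 (fstE (.var 6)))) (.seq (.assign 9 (.arr 2 (sndE (.var 6))))
    (.ite (neq (.var 8) (.var 9)) relabelProg (.assign 5 (.add (.var 5) (.const 1)))))

/-- Compute labels of the components of the edges satisfying `cond` in array `2` and their
nullity in register `5`. -/
def componentsProg (cond : Expr) : Prog :=
  .seq (.assign 5 (.const 0)) (.seq (forLoop 7 (.var 3) (.store 2 (.var 7) (.var 7)))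
    (forLoop 6 (.var 4) (.ite cond addEdgeProg .skip)))

variable {I : Instance} {N : ℕ} {s : State}

/-- Both labels are held in registers that the loop does not change, so overwriting entries of the
array does not disturb later comparisons. -/
lemma runs_relabelProg (hI : Knows I s) (hN : I.numVertices ≤ N) :
    Runs N relabelProg s fun s' => ∀ x < I.numVertices,
      s'.arr 2 x = if s.arr 2 x = s.var 9 then s.var 8 else s.arr 2 x := by
  refine runs_forLoop hN (fun j s' => ∀ x < I.numVertices, s'.arr 2 x =
    if x < j ∧ s.arr 2 x = s.var 9 then s.var 8 else s.arr 2 x) rfl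
    (fun s' hF => (hF.var 3 rfl).trans hI.vertices) (by simp) (fun _ _ _ h => h) ?_ ?_
  · intro j hj s' hF h7 hinv
    have h9 := hF.var 9 rfl
    have h8 := hF.var 8 rfl
    have hcur := hinv j hj
    rw [if_neg (by simp)] at hcur
    refine runs_ite (fun he => runs_skip ?_) fun he => runs_store ?_
    · intro x hx
      rw [hinv x hx]
      simp only [eval_neq, Expr.eval, h7, h9, hcur] at he
      refine if_congr ⟨fun h => ⟨by omega, h.2⟩, fun h => ⟨?_, h.2⟩⟩ rfl rfl
      rcases Nat.lt_succ_iff_lt_or_eq.1 h.1 with h' | rfl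
      · exact h'
      · have := h.2
        omega
    · intro x hx
      simp only [eval_neq, Expr.eval, h7, h9, hcur] at he
      simp only [State.arr_setArr, Expr.eval, h7, h8, true_and]
      by_cases hxj : x = j
      · subst hxj
        rw [if_pos rfl, if_pos ⟨by omega, by omega⟩]
      · rw [if_neg hxj, hinv x hx]
        refine if_congr (and_congr_left fun _ => ?_) rfl rfl
        omega
  · intro s' hF hinv x hx
    rw [hinv x hx]
    simp [hx]

/-- Equal labels at the ends mean that the vector of `e` is already spanned: then only the nullity
grows. Otherwise two components merge and the nullity stays. -/
lemma runs_addEdgeProg (hI : Knows I s) (hN : I.numVertices ≤ N) {e : Fin I.numEdges}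
    (he : s.var 6 = e) {A : Finset (Fin I.numEdges)} (heA : e ∉ A)
    (hl : I.Labels A (s.arr 2)) (hn : s.var 5 = nullity (inc I.natEnds) A) :
    Runs N addEdgeProg s fun s' => I.Labels (insert e A : Finset _) (s'.arr 2) ∧
      s'.var 5 = nullity (inc I.natEnds) (insert e A) := by
  have hfst := hI.fst e
  have hsnd := hI.snd e
  have hiff := hl.eq_iff (natEnds_lt e).1 (natEnds_lt e).2
  refine Runs.seq (runs_assign (Runs.seq (runs_assign ?_)))
  simp only [fstE, sndE, Expr.eval, State.var_setVar, State.arr_setVar, he, hfst]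
  rw [if_neg (by decide), hsnd, Finset.coe_insert]
  refine runs_ite (fun hne => ?_) fun heq => runs_assign ?_
  · simp only [eval_neq, Expr.eval, State.var_setVar] at hne
    have hne' : s.arr 2 (I.natEnds e).1 ≠ s.arr 2 (I.natEnds e).2 := by
      intro h
      simp [h] at hne
    have hK : Knows I ((s.setVar 8 (s.arr 2 (I.natEnds e).1)).setVar 9
        (s.arr 2 (I.natEnds e).2)) :=
      ⟨hI.colors, hI.budget, hI.vertices, hI.edges, hI.fst, hI.snd, hI.col⟩
    refine (runs_relabelProg hK hN).mono fun s' hF h => ⟨?_, ?_⟩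
    · refine (hl.insert_merge e).congr fun x hx => ?_
      rw [h x hx]
      simp
    · rw [hF.var 5 rfl, nullity_insert_of_notMem heA (fun h' => hne' (hiff.2 h')), ← hn]
      rfl
  · simp only [eval_neq, Expr.eval, State.var_setVar] at heq
    have heq' : s.arr 2 (I.natEnds e).1 = s.arr 2 (I.natEnds e).2 := by
      simp at heq
      omega
    refine ⟨?_, ?_⟩
    · exact hl.insert_of_eq heq'
    · rw [nullity_insert_of_mem heA (hiff.1 heq'), ← hn]
      simp

lemma runs_componentsProg {cond : Expr} (hI : Knows I s) (hn : I.numVertices ≤ N)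
    (hM : I.numEdges ≤ N) (A : Finset (Fin I.numEdges))
    (hcond : ∀ s', Frame (componentsProg cond) s s' → ∀ e : Fin I.numEdges, s'.var 6 = e →
      (cond.eval s' ≠ 0 ↔ e ∈ A)) :
    Runs N (componentsProg cond) s fun s' => I.Labels A (s'.arr 2) ∧
      s'.var 5 = nullity (inc I.natEnds) A := by
  classical
  set s₁ := s.setVar 5 0 with hs₁
  have hF₁ : Frame (componentsProg cond) s s₁ := by
    refine ⟨fun x hx => ?_, fun _ _ => rfl, fun _ => rfl⟩
    have hx : x ≠ 5 := fun h => by subst h; simp [componentsProg, Prog.modVar] at hx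
    simp [hs₁, hx]
  refine Runs.seq (runs_assign (Runs.seq ?_))
  refine runs_forLoop hn (fun j s' => s'.var 5 = 0 ∧ ∀ x < j, s'.arr 2 x = x) rfl
    (fun s' hF => (hF.var 3 rfl).trans hI.vertices) (by simp) (fun _ _ _ h => by simpa using h)
    ?_ ?_
  · rintro j hj s' hF h7 ⟨h5, hinv⟩
    refine runs_store ⟨h5, fun x hx => ?_⟩
    simp only [State.arr_setArr, Expr.eval, h7, true_and]
    split_ifs with h
    · exact h.symm
    · exact hinv x (by omega)
  · rintro s₂ hF ⟨h5, hinv⟩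
    have hF₂ : Frame (componentsProg cond) s s₂ := by
      refine hF₁.trans (hF.mono ?_ ?_ ?_) <;>
        simp +contextual [componentsProg, Prog.modVar, Prog.modArr, Prog.modOut]
    have hI₂ : Knows I s₂ := (show Knows I s₁ from
      ⟨hI.colors, hI.budget, hI.vertices, hI.edges, hI.fst, hI.snd, hI.col⟩).frame hF
      ⟨rfl, rfl, rfl, rfl, rfl, rfl⟩
    refine runs_forLoop hM (fun j s' => I.Labels (A.filter fun e : Fin I.numEdges => (e : ℕ) < j) (s'.arr 2) ∧
      s'.var 5 = nullity (inc I.natEnds) (A.filter fun e : Fin I.numEdges => (e : ℕ) < j)) rfl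
      (fun s' hF => (hF.var 4 rfl).trans hI₂.edges) ?_ (fun _ _ _ h => by simpa using h) ?_ ?_
    · simp only [Nat.not_lt_zero, Finset.filter_false]
      refine ⟨?_, ?_⟩
      · rw [Finset.coe_empty]
        exact labels_id.congr fun x hx => hinv x hx
      · rw [h5, nullity, Finset.card_empty, Nat.zero_sub]
    · rintro j hj s' hF' h6 ⟨hl, hnul⟩
      have hF'' : Frame (componentsProg cond) s s' := by
        refine hF₂.trans (hF'.mono ?_ ?_ ?_) <;>
          simp +contextual [componentsProg, Prog.modVar, Prog.modArr, Prog.modOut]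
      have hc := hcond s' hF'' ⟨j, hj⟩ h6
      refine runs_ite (fun he => ?_) fun he => runs_skip ?_
      · have hset : A.filter (fun e : Fin I.numEdges => (e : ℕ) < j + 1) =
            insert ⟨j, hj⟩ (A.filter fun e : Fin I.numEdges => (e : ℕ) < j) := by
          ext e
          simp only [Finset.mem_filter, Finset.mem_insert, Fin.ext_iff]
          constructor
          · rintro ⟨h1, h2⟩
            by_cases h : (e : ℕ) = j
            · exact Or.inl h
            · exact Or.inr ⟨h1, by omega⟩
          · rintro (h | h)
            · exact ⟨(Fin.ext h : e = ⟨j, hj⟩) ▸ hc.1 he, by omega⟩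
            · exact ⟨h.1, by omega⟩
        rw [hset]
        exact runs_addEdgeProg (hI₂.frame hF' ⟨rfl, rfl, rfl, rfl, rfl, rfl⟩) hn h6 (by simp) hl
          hnul
      · have hset : A.filter (fun e : Fin I.numEdges => (e : ℕ) < j + 1) = A.filter fun e : Fin I.numEdges => (e : ℕ) < j := by
          refine Finset.filter_congr fun e heA => ⟨fun h => ?_, fun h => by omega⟩
          by_contra h'
          have : e = ⟨j, hj⟩ := Fin.ext (by simp only; omega)
          exact hc.2 (this ▸ heA) he
        rw [hset]
        exact ⟨hl, hnul⟩
    · rintro s' hF' h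
      have hset : A.filter (fun e : Fin I.numEdges => (e : ℕ) < I.numEdges) = A :=
        Finset.filter_true_of_mem fun e _ => e.2
      rwa [hset] at h

end RAM

/-! ### Computing the nullities and the representatives -/

namespace RAM

open SimFES SimFES.Instance

variable {I : Instance} {N : ℕ} {s : State}

lemma Knows.setVar (h : Knows I s) {r : ℕ} (hr : 4 < r) (v : ℕ) : Knows I (s.setVar r v) where
  colors := by rw [State.var_setVar, if_neg (by omega), h.colors]
  budget := by rw [State.var_setVar, if_neg (by omega), h.budget]
  vertices := by rw [State.var_setVar, if_neg (by omega), h.vertices]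
  edges := by rw [State.var_setVar, if_neg (by omega), h.edges]
  fst := h.fst
  snd := h.snd
  col := h.col

/-- Membership in the edges whose colour is in register `10`, except for those in registers `11`
and `12`. -/
def seriesCond : Expr :=
  .sub (.sub (colE (.var 6) (.var 10)) (.sub (.const 1) (neq (.var 6) (.var 11))))
    (.sub (.const 1) (neq (.var 6) (.var 12)))

/-- Compute the nullity of the edges of the colour in register `10` without two of them. -/
def nullityProg (x y : Expr) : Prog :=
  .seq (.assign 11 x) (.seq (.assign 12 y) (componentsProg seriesCond))

lemma runs_nullityProg (hI : Knows I s) (hn : I.numVertices ≤ N) (hM : I.numEdges ≤ N)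
    {i : Fin I.numColors} (hi : s.var 10 = i) {x y : Expr} {a b : ℕ} (hx : x.eval s = a)
    (hy : y.eval (s.setVar 11 a) = b) :
    Runs N (nullityProg x y) s fun s' => s'.var 5 = nullity (inc I.natEnds)
      ((I.colorEdges i).filter fun e : Fin I.numEdges => (e : ℕ) ≠ a ∧ (e : ℕ) ≠ b) := by
  refine Runs.seq (runs_assign (Runs.seq (runs_assign ?_)))
  rw [hx, hy]
  have hK := (hI.setVar (r := 11) (by omega) a).setVar (r := 12) (by omega) b
  refine (runs_componentsProg hK hn hM _ fun s' hF e he => ?_).mono fun s' _ h => h.2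
  have h10 : s'.var 10 = i := (hF.var 10 rfl).trans hi
  have h11 : s'.var 11 = a := hF.var 11 rfl
  have h12 : s'.var 12 = b := hF.var 12 rfl
  have hc := (hK.frame hF ⟨rfl, rfl, rfl, rfl, rfl, rfl⟩).col e i
  simp only [seriesCond, colE, eval_neq, Expr.eval, he, h10, h11, h12, hc, colorEdges,
    Finset.mem_filter, Finset.mem_univ, true_and]
  split_ifs with h
  · simp only [h, true_and]
    omega
  · simp [h]

/-- The number `numEdges` is not the index of an edge; it serves as the dummy argument of
`nullityProg` that excludes nothing. -/
lemma filter_ne_numEdges (A : Finset (Fin I.numEdges)) :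
    (A.filter fun e : Fin I.numEdges => (e : ℕ) ≠ I.numEdges ∧ (e : ℕ) ≠ I.numEdges) = A :=
  Finset.filter_true_of_mem fun e _ => ⟨e.2.ne, e.2.ne⟩

/-- Add up the nullities of the colours in register `13`, and set register `14` if one of them
exceeds the budget. -/
def countProg : Prog :=
  forLoop 10 (.var 1) (.seq (nullityProg (.var 4) (.var 4))
    (.seq (.assign 13 (.add (.var 13) (.var 5)))
      (.ite (.sub (.var 5) (.var 2)) (.assign 14 (.const 1)) .skip)))

lemma runs_countProg (hI : Knows I s) (hn : I.numVertices ≤ N) (hM : I.numEdges ≤ N)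
    (hα : I.numColors ≤ N) (h13 : s.var 13 = 0) (h14 : s.var 14 = 0) :
    Runs N countProg s fun s' => s'.var 13 = ∑ i, I.colorNullity i ∧
      (s'.var 14 ≠ 0 ↔ ∃ i, I.budget < I.colorNullity i) := by
  refine runs_forLoop hα (fun j s' =>
    s'.var 13 = (((List.finRange I.numColors).take j).map I.colorNullity).sum ∧
      (s'.var 14 ≠ 0 ↔ ∃ i ∈ (List.finRange I.numColors).take j, I.budget < I.colorNullity i)) rfl
    (fun s' hF => (hF.var 1 rfl).trans hI.colors) (by simp [h13, h14])
    (fun j s' x h => by simpa using h) ?_ ?_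
  · rintro j hj s' hF h10 ⟨hsum, hbad⟩
    have hK := hI.frame hF ⟨rfl, rfl, rfl, rfl, rfl, rfl⟩
    refine Runs.seq ((runs_nullityProg hK hn hM (i := ⟨j, hj⟩) h10 (x := .var 4)
      (y := .var 4) hK.edges hK.edges).mono
      fun s₁ hF₁ h5 => ?_)
    rw [filter_ne_numEdges] at h5
    have h13' := (hF₁.var 13 rfl).trans hsum
    rw [← show s₁.var 14 = s'.var 14 from hF₁.var 14 rfl] at hbad
    have h2 := (hF₁.var 2 rfl).trans hK.budget
    have h5' : s₁.var 5 = I.colorNullity ⟨j, hj⟩ := h5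
    simp only [take_succ_finRange hj, List.map_append, List.sum_append, List.mem_append,
      List.map_singleton, List.sum_singleton, List.mem_singleton, or_and_right, exists_or,
      exists_eq_left]
    refine Runs.seq (runs_assign (runs_ite (fun he => runs_assign ?_) fun he => runs_skip ?_))
    · simp only [Expr.eval, State.var_setVar, h2, h5'] at he
      refine ⟨by simp [h13', h5'], iff_of_true (by simp) (Or.inr ?_)⟩
      simp at he
      omega
    · simp only [Expr.eval, State.var_setVar, h2, h5'] at he
      refine ⟨by simp [h13', h5'], ?_⟩
      rw [or_iff_left (by simp at he; omega), ← hbad]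
      simp
  · rintro s' - ⟨hsum, hbad⟩
    rw [List.take_of_length_le (by simp)] at hsum hbad
    rw [Fin.sum_univ_def]
    exact ⟨hsum, by simpa using hbad⟩

/-- Test whether the edges in registers `16` and `17` are in series in every colour. -/
def sameProg : Prog :=
  .seq (.assign 19 (.const 1)) (forLoop 10 (.var 1)
    (.seq (nullityProg (.var 16) (.var 17)) (.seq (.assign 20 (.var 5))
      (.seq (nullityProg (.var 16) (.var 4)) (.seq (.assign 21 (.var 5))
        (.seq (nullityProg (.var 4) (.var 17))
          (.ite (.add (neq (.var 20) (.var 21)) (neq (.var 20) (.var 5)))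
            (.assign 19 (.const 0)) .skip)))))))

lemma filter_ne_eq_erase (A : Finset (Fin I.numEdges)) (e f : Fin I.numEdges) :
    (A.filter fun x : Fin I.numEdges => (x : ℕ) ≠ e ∧ (x : ℕ) ≠ f) = (A.erase e).erase f ∧
    (A.filter fun x : Fin I.numEdges => (x : ℕ) ≠ e ∧ (x : ℕ) ≠ I.numEdges) = A.erase e ∧
    (A.filter fun x : Fin I.numEdges => (x : ℕ) ≠ I.numEdges ∧ (x : ℕ) ≠ f) = A.erase f := by
  refine ⟨?_, ?_, ?_⟩ <;> ext x <;> have := x.2.ne <;>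
    simp only [Finset.mem_filter, Finset.mem_erase, ne_eq, Fin.ext_iff] <;> tauto

lemma runs_sameProg (hI : Knows I s) (hn : I.numVertices ≤ N) (hM : I.numEdges ≤ N)
    (hα : I.numColors ≤ N) {e f : Fin I.numEdges} (he : s.var 16 = e) (hf : s.var 17 = f) :
    Runs N sameProg s fun s' => s'.var 19 ≠ 0 ↔ I.Same e f := by
  refine Runs.seq (runs_assign ?_)
  have hI₁ := hI.setVar (r := 19) (by omega) 1
  refine runs_forLoop hα (fun j s' => s'.var 19 ≠ 0 ↔ ∀ i ∈ (List.finRange I.numColors).take j,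
      (seriesSetoid (inc I.natEnds) (I.colorEdges i)).r e f) rfl
    (fun s' hF => (hF.var 1 rfl).trans hI₁.colors) (by simp)
    (fun j s' x h => by simpa using h) ?_ ?_
  · rintro j hj s' hF h10 hinv
    have h16 : s'.var 16 = e := (hF.var 16 rfl).trans he
    have h17 : s'.var 17 = f := (hF.var 17 rfl).trans hf
    have hK := hI₁.frame hF ⟨rfl, rfl, rfl, rfl, rfl, rfl⟩
    obtain ⟨hef, hee, hff⟩ := filter_ne_eq_erase (I.colorEdges ⟨j, hj⟩) e f
    refine Runs.seq ((runs_nullityProg hK hn hM (i := ⟨j, hj⟩) h10 (x := .var 16)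
      (y := .var 17) h16 h17).mono
      fun s₁ hF₁ h₁ => ?_)
    rw [hef] at h₁
    refine Runs.seq (runs_assign ?_)
    have hK₁ := (hK.frame hF₁ ⟨rfl, rfl, rfl, rfl, rfl, rfl⟩).setVar (r := 20) (by omega)
      (s₁.var 5)
    refine Runs.seq ((runs_nullityProg hK₁ hn hM (i := ⟨j, hj⟩) ((hF₁.var 10 rfl).trans h10)
      (x := .var 16) (y := .var 4) ((hF₁.var 16 rfl).trans h16) hK₁.edges).mono fun s₂ hF₂ h₂ => ?_)
    rw [hee] at h₂
    refine Runs.seq (runs_assign ?_)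
    have hK₂ := (hK₁.frame hF₂ ⟨rfl, rfl, rfl, rfl, rfl, rfl⟩).setVar (r := 21) (by omega)
      (s₂.var 5)
    refine Runs.seq ((runs_nullityProg hK₂ hn hM (i := ⟨j, hj⟩) (x := .var 4) (y := .var 17)
      ((hF₂.var 10 rfl).trans ((hF₁.var 10 rfl).trans h10)) hK₂.edges
      ((hF₂.var 17 rfl).trans ((hF₁.var 17 rfl).trans h17))).mono fun s₃ hF₃ h₃ => ?_)
    rw [hff] at h₃
    have h20 : s₃.var 20 = _ := (hF₃.var 20 rfl).trans ((hF₂.var 20 rfl).trans h₁)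
    have h21 : s₃.var 21 = _ := (hF₃.var 21 rfl).trans h₂
    have h19 : s₃.var 19 = s'.var 19 :=
      (hF₃.var 19 rfl).trans ((hF₂.var 19 rfl).trans (hF₁.var 19 rfl))
    -- Registers `20`, `21` and `5` now hold the nullities without both edges, without `e`, and
    -- without `f`; the edges are in series in this colour exactly when all three agree.
    have hser : (seriesSetoid (inc I.natEnds) (I.colorEdges ⟨j, hj⟩)).r e f ↔ _ :=
      series_iff_nullity
    simp only [take_succ_finRange hj, List.mem_append, List.mem_singleton, or_imp, forall_and,
      forall_eq, hser]
    rw [← hinv, ← h19]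
    refine runs_ite (fun hne => runs_assign ?_) fun heq => runs_skip ?_
    · simp only [eval_neq, Expr.eval, h20, h21, h₃] at hne
      refine iff_of_false (by simp) fun h => hne ?_
      rw [← h.2.1, ← h.2.2]
      simp
    · simp only [eval_neq, Expr.eval, h20, h21, h₃] at heq
      rw [and_iff_left]
      omega
  · rintro s' - hinv
    rw [List.take_of_length_le (by simp)] at hinv
    rw [hinv]
    simp [Same]

/-- Test whether the edge in register `16` is a representative. -/
def newProg : Prog :=
  .seq (.assign 18 (.const 1)) (forLoop 17 (.var 16)
    (.seq sameProg (.ite (.var 19) (.assign 18 (.const 0)) .skip)))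

lemma runs_newProg (hI : Knows I s) (hn : I.numVertices ≤ N) (hM : I.numEdges ≤ N)
    (hα : I.numColors ≤ N) {e : Fin I.numEdges} (he : s.var 16 = e) :
    Runs N newProg s fun s' => s'.var 18 ≠ 0 ↔ I.IsRep e := by
  refine Runs.seq (runs_assign ?_)
  have hI₁ := hI.setVar (r := 18) (by omega) 1
  refine runs_forLoop (e.2.le.trans hM) (fun j s' => s'.var 18 ≠ 0 ↔
      ∀ f : Fin I.numEdges, (f : ℕ) < j → ¬ I.Same f e) rfl
    (fun s' hF => (hF.var 16 rfl).trans he) (by simp) (fun j s' x h => by simpa using h) ?_ ?_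
  · rintro j hj s' hF h17 hinv
    have h16 : s'.var 16 = e := (hF.var 16 rfl).trans he
    have hK := hI₁.frame hF ⟨rfl, rfl, rfl, rfl, rfl, rfl⟩
    set f : Fin I.numEdges := ⟨j, hj.trans e.2⟩ with hf
    refine Runs.seq ((runs_sameProg hK hn hM hα (f := f) h16 h17).mono fun s₁ hF₁ h₁ => ?_)
    rw [← show s₁.var 18 = s'.var 18 from hF₁.var 18 rfl] at hinv
    refine runs_ite (fun h => runs_assign ?_) fun h => runs_skip ?_
    · exact iff_of_false (by simp) fun h' => h' f (by simp [hf]) (h₁.1 h).symm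
    · rw [hinv]
      refine ⟨fun h' g hg => ?_, fun h' g hg => h' g (by omega)⟩
      rcases Nat.lt_succ_iff_lt_or_eq.1 hg with hg | hg
      · exact h' g hg
      · have : g = f := Fin.ext hg
        subst this
        exact fun hs => h₁.2 hs.symm h
  · rintro s' - hinv
    exact hinv

/-- Append the edge in register `16` to the list of representatives. -/
def recordProg : Prog :=
  .seq (.store 3 (.var 16) (.const 1)) (.seq (.store 4 (.var 15) (.var 16))
    (.seq (.store 5 (.add (.var 15) (.var 15)) (fstE (.var 16)))
      (.seq (.store 5 (.add (.add (.var 15) (.var 15)) (.const 1)) (sndE (.var 16)))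
        (.assign 15 (.add (.var 15) (.const 1))))))

/-- Compute the representatives. -/
def repsProg : Prog :=
  .seq (.assign 15 (.const 0)) (forLoop 16 (.var 4) (.seq newProg (.ite (.var 18) recordProg .skip)))

/-- The memory holds the representatives from a list. -/
structure Stores (I : Instance) (L : List (Fin I.numEdges)) (s : State) : Prop where
  count : s.var 15 = L.length
  mark : ∀ e : Fin I.numEdges, s.arr 3 e = if e ∈ L then 1 else 0
  edge : ∀ (t : ℕ) (e : Fin I.numEdges), L[t]? = some e → s.arr 4 t = e
  fst : ∀ (t : ℕ) (e : Fin I.numEdges), L[t]? = some e → s.arr 5 (t + t) = (I.natEnds e).1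
  snd : ∀ (t : ℕ) (e : Fin I.numEdges), L[t]? = some e → s.arr 5 (t + t + 1) = (I.natEnds e).2

lemma Stores.frame {L : List (Fin I.numEdges)} (h : Stores I L s) {p : Prog} {s' : State}
    (hF : Frame p s s') (h15 : p.modVar 15 = false)
    (hp : p.modArr 3 = false ∧ p.modArr 4 = false ∧ p.modArr 5 = false) : Stores I L s' := by
  have a3 := hF.arr 3 hp.1
  have a4 := hF.arr 4 hp.2.1
  have a5 := hF.arr 5 hp.2.2
  exact ⟨(hF.var 15 h15).trans h.count, by simpa only [a3] using h.mark,
    by simpa only [a4] using h.edge, by simpa only [a5] using h.fst, by simpa only [a5] using h.snd⟩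

lemma runs_recordProg (hI : Knows I s) {L : List (Fin I.numEdges)} (hL : Stores I L s)
    {e : Fin I.numEdges} (he : s.var 16 = e) :
    Runs N recordProg s fun s' => Stores I (L ++ [e]) s' := by
  refine Runs.seq (runs_store (Runs.seq (runs_store (Runs.seq (runs_store (Runs.seq (runs_store
    (runs_assign ?_))))))))
  have hlt : ∀ t f, L[t]? = some f → t < L.length := fun t f h =>
    (List.getElem?_eq_some_iff.1 h).1
  have hget : ∀ t f, (L ++ [e])[t]? = some f → L[t]? = some f ∨ t = L.length ∧ f = e := by
    intro t f h
    rw [List.getElem?_append] at h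
    split_ifs at h with ht
    · exact Or.inl h
    · right
      obtain ⟨h1, h2⟩ := List.getElem?_eq_some_iff.1 h
      simp only [List.length_singleton] at h1
      refine ⟨by omega, ?_⟩
      simpa using h2.symm
  refine ⟨?_, ?_, ?_, ?_, ?_⟩
  · simp [hL.count]
  · intro f
    have := hL.mark f
    simp only [State.arr_setVar, State.arr_setArr, State.var_setArr, Expr.eval, he, this,
      List.mem_append, List.mem_singleton, ← Fin.ext_iff]
    by_cases hf : f = e <;> simp [hf]
  · intro t f h
    simp only [State.arr_setVar, State.arr_setArr, State.var_setArr, Expr.eval, he, hL.count]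
    rcases hget t f h with h | ⟨rfl, rfl⟩
    · have := hlt t f h
      simp [hL.edge t f h, this.ne]
    · simp
  · intro t f h
    simp only [State.arr_setVar, State.arr_setArr, State.var_setArr, Expr.eval, he, hL.count,
      fstE, sndE]
    rcases hget t f h with h | ⟨rfl, rfl⟩
    · have := hlt t f h
      rw [if_neg (by omega), if_neg (by omega)]
      simp [hL.fst t f h]
    · rw [if_neg (by omega)]
      simp [hI.fst]
  · intro t f h
    simp only [State.arr_setVar, State.arr_setArr, State.var_setArr, Expr.eval, he, hL.count,
      fstE, sndE]
    rcases hget t f h with h | ⟨rfl, rfl⟩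
    · have := hlt t f h
      rw [if_neg (by omega), if_neg (by omega)]
      simp [hL.snd t f h]
    · simp [hI.snd]

/-- Array `3` must be zero at the start because marks are only ever set. Edges are visited in
increasing order, which is the order of `reps`. -/
lemma runs_repsProg (hI : Knows I s) (hn : I.numVertices ≤ N) (hM : I.numEdges ≤ N)
    (hα : I.numColors ≤ N) (h3 : ∀ e, s.arr 3 e = 0) :
    Runs N repsProg s fun s' => Stores I I.reps s' := by
  classical
  refine Runs.seq (runs_assign ?_)
  have hI₁ := hI.setVar (r := 15) (by omega) 0
  refine runs_forLoop hM
    (fun j s' => Stores I (((List.finRange I.numEdges).take j).filter I.IsRep) s') rfl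
    (fun s' hF => (hF.var 4 rfl).trans hI₁.edges) ?_ (fun j s' x h => ?_) ?_ ?_
  · exact ⟨by simp, by simp [h3], by simp, by simp, by simp⟩
  · exact ⟨by simpa using h.count, h.mark, h.edge, h.fst, h.snd⟩
  · rintro j hj s' hF h16 hinv
    have hK := hI₁.frame hF ⟨rfl, rfl, rfl, rfl, rfl, rfl⟩
    set e : Fin I.numEdges := ⟨j, hj⟩
    rw [take_succ_finRange hj, List.filter_append]
    refine Runs.seq ((runs_newProg hK hn hM hα (e := e) h16).mono fun s₁ hF₁ h₁ => ?_)
    have hS := hinv.frame hF₁ rfl ⟨rfl, rfl, rfl⟩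
    refine runs_ite (fun h => ?_) fun h => runs_skip ?_
    · rw [List.filter_singleton, decide_eq_true (h₁.1 h), cond_true]
      exact runs_recordProg (hK.frame hF₁ ⟨rfl, rfl, rfl, rfl, rfl, rfl⟩) hS
        ((hF₁.var 16 rfl).trans h16)
    · rw [List.filter_singleton, decide_eq_false fun h' => h₁.2 h' h, cond_false, List.append_nil]
      exact hS
  · rintro s' - hinv
    rw [List.take_of_length_le (by simp)] at hinv
    unfold reps
    convert hinv

end RAM

/-! ### Writing the kernel -/

namespace SimFES.Instance

variable (I : Instance)

open Classical in
/-- The encoding of an edge of the compressed instance. -/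
noncomputable def record (x : Fin I.numReps ⊕ (Fin I.numColors × Fin (2 * I.numReps))) : List ℕ :=
  [((compEnds I.src I.tgt I.anchor x).1 : ℕ), ((compEnds I.src I.tgt I.anchor x).2 : ℕ)] ++
    (List.finRange I.numColors).map fun i =>
      if x ∈ compColor I.colorEdges I.repEdge I.anchor i then 1 else 0

lemma encode_compressed : I.compressed.encode =
    [I.numColors, I.budget, 2 * I.numReps, I.numReps + I.numColors * (2 * I.numReps)] ++
      List.range (2 * I.numReps) ++
      (((List.finRange I.numReps).flatMap fun j => I.record (.inl j)) ++
        (List.finRange I.numColors).flatMap fun i =>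
          (List.finRange (2 * I.numReps)).flatMap fun p => I.record (.inr (i, p))) := by
  rw [compressed, encode_ofEdges, length_compEdges]
  congr 1
  rw [compEdges, List.flatMap_append, List.flatMap_map, List.flatMap_assoc]
  simp only [List.flatMap_map]
  rfl

lemma record_inl (j : Fin I.numReps) : I.record (.inl j) = [(j : ℕ) + j, j + j + 1] ++
    (List.finRange I.numColors).map fun i => if i ∈ I.col (I.repEdge j) then 1 else 0 := by
  rw [record]
  congr 1
  · simp [compEnds, src, tgt, two_mul]
  · refine List.map_congr_left fun i _ => ?_
    have : Sum.inl j ∈ compColor I.colorEdges I.repEdge I.anchor i ↔ i ∈ I.col (I.repEdge j) := by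
      simp [compColor, links, colorEdges]
    simp only [this]

/-- The sum of the two truncated differences is the distance of two numbers. The arithmetic term is
therefore `1` exactly when the colours agree and the anchor differs from `p`; a link at its own
anchor is a loop without colours. -/
lemma record_inr (i : Fin I.numColors) (p : Fin (2 * I.numReps)) :
    I.record (.inr (i, p)) = [(p : ℕ), (I.anchor i p : ℕ)] ++
      (List.finRange I.numColors).map fun i' : Fin I.numColors =>
        1 - (((i' : ℕ) - i) + (i - i')) -
          (1 - (((I.anchor i p : ℕ) - p) + ((p : ℕ) - I.anchor i p))) := by
  rw [record]
  congr 1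
  refine List.map_congr_left fun i' _ => ?_
  have hmem : (Sum.inr (i, p) : Fin I.numReps ⊕ (Fin I.numColors × Fin (2 * I.numReps))) ∈
      compColor I.colorEdges I.repEdge I.anchor i' ↔
        (i' : ℕ) = i ∧ (I.anchor i p : ℕ) ≠ p := by
    simp only [compColor, links, Set.mem_union, Set.mem_ofPred_eq, Sum.inr.injEq, Prod.mk.injEq,
      Set.mem_image, reduceCtorEq, and_false, exists_false, or_false, ne_eq, ← Fin.ext_iff]
    constructor
    · rintro ⟨q, ⟨rfl, rfl⟩, h⟩
      exact ⟨rfl, h⟩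
    · rintro ⟨rfl, h⟩
      exact ⟨p, ⟨rfl, rfl⟩, h⟩
  split_ifs with h
  · rw [hmem] at h
    omega
  · rw [hmem] at h
    omega

end SimFES.Instance

namespace RAM

open SimFES SimFES.Instance

variable {I : Instance} {N : ℕ} {s : State}

lemma Stores.repEdge (h : Stores I I.reps s) (j : Fin I.numReps) : s.arr 4 j = I.repEdge j :=
  h.edge j _ (List.getElem?_eq_getElem j.2)

/-- Cells `2 * t` and `2 * t + 1` hold the ends of the `t`-th representative, so the parity of `p`
selects the end. -/
lemma Stores.orig (h : Stores I I.reps s) (p : Fin (2 * I.numReps)) : s.arr 5 p = I.orig p := by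
  have hget : I.reps[(p : ℕ) / 2]? = some (I.repEdge (I.owner p)) :=
    List.getElem?_eq_getElem (I.owner p).2
  rw [Instance.orig]
  split_ifs with hp
  · have := h.fst _ _ hget
    rwa [show (p : ℕ) / 2 + p / 2 = p by omega] at this
  · have := h.snd _ _ hget
    rwa [show (p : ℕ) / 2 + p / 2 + 1 = p by omega] at this

lemma orig_lt (p : Fin (2 * I.numReps)) : I.orig p < I.numVertices := by
  rw [Instance.orig]
  split_ifs
  · exact (natEnds_lt _).1
  · exact (natEnds_lt _).2

lemma flatMap_singleton_eq_map {α : Type*} (l : List α) (f : α → ℕ) :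
    (l.flatMap fun x => [f x]) = l.map f := List.map_eq_flatMap.symm

/-- Write the numbers of colours, vertices and edges, the budget, and the vertices. -/
def headerProg : Prog :=
  .seq (.assign 27 (.add (.var 15) (.var 15))) (.seq (.assign 22 (.var 15))
    (.seq (forLoop 10 (.var 1) (.assign 22 (.add (.var 22) (.var 27))))
      (.seq (.write (.var 1)) (.seq (.write (.var 2)) (.seq (.write (.var 27))
        (.seq (.write (.var 22)) (forLoop 23 (.var 27) (.write (.var 23)))))))))

lemma runs_headerProg (hI : Knows I s) (hα : I.numColors ≤ N) (hr : 2 * I.numReps ≤ N)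
    (hS : Stores I I.reps s) :
    Runs N headerProg s fun s' => s'.var 27 = 2 * I.numReps ∧ s'.out = s.out ++
      ([I.numColors, I.budget, 2 * I.numReps, I.numReps + I.numColors * (2 * I.numReps)] ++
        List.range (2 * I.numReps)) := by
  refine Runs.seq (runs_assign (Runs.seq (runs_assign ?_)))
  simp only [Expr.eval, hS.count, State.var_setVar]
  have hI₁ := (hI.setVar (r := 27) (by omega) (I.reps.length + I.reps.length)).setVar (r := 22)
    (by omega) (if 15 = 27 then I.reps.length + I.reps.length else I.reps.length)
  refine Runs.seq ?_
  -- The machine cannot multiply, so the number of edges is accumulated colour by colour.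
  refine runs_forLoop hα (fun j s' => s'.var 22 = I.numReps + j * (2 * I.numReps)) rfl
    (fun s' hF => (hF.var 1 rfl).trans hI₁.colors) (by simp [numReps])
    (fun j s' x h => by simpa using h) ?_ ?_
  · intro j hj s' hF _ hinv
    refine runs_assign ?_
    have h27 : s'.var 27 = I.numReps + I.numReps := hF.var 27 rfl
    simp only [Expr.eval, State.var_setVar, if_true, hinv, h27]
    ring
  · intro s₂ hF hinv
    have hI₂ := hI₁.frame hF ⟨rfl, rfl, rfl, rfl, rfl, rfl⟩
    have h27 : s₂.var 27 = 2 * I.numReps := (hF.var 27 rfl).trans (two_mul _).symm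
    have hout : s₂.out = s.out := hF.out rfl
    refine Runs.seq (runs_write (Runs.seq (runs_write (Runs.seq (runs_write (Runs.seq
      (runs_write ?_)))))))
    simp only [Expr.eval, State.var_push, h27, hinv, hI₂.colors, hI₂.budget]
    refine runs_forLoop_out hr (fun j => [(j : ℕ)]) rfl (fun s' hF => (hF.var 27 rfl).trans h27) ?_
      fun s' hF h => ⟨(hF.var 27 rfl).trans h27, ?_⟩
    · intro j s' hF hj
      exact runs_write (by simp [hj])
    · rw [h, flatMap_singleton_eq_map]
      simp [hout, List.map_coe_finRange_eq_range]

/-- Write the edges between the two copies of the ends of the representatives. -/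
def writeRepsProg : Prog :=
  forLoop 24 (.var 15) (.seq (.write (.add (.var 24) (.var 24)))
    (.seq (.write (.add (.add (.var 24) (.var 24)) (.const 1)))
      (forLoop 10 (.var 1) (.write (colE (.arr 4 (.var 24)) (.var 10))))))

lemma runs_writeRepsProg (hI : Knows I s) (hα : I.numColors ≤ N) (hr : 2 * I.numReps ≤ N)
    (hS : Stores I I.reps s) :
    Runs N writeRepsProg s fun s' => s'.out = s.out ++
      (List.finRange I.numReps).flatMap fun j => I.record (.inl j) := by
  refine runs_forLoop_out (by omega) (fun j => I.record (.inl j)) rfl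
    (fun s' hF => (hF.var 15 rfl).trans hS.count) ?_ fun s' _ h => h
  intro j s₁ hF hj
  have hI₁ := hI.frame hF ⟨rfl, rfl, rfl, rfl, rfl, rfl⟩
  have hS₁ := hS.frame hF rfl ⟨rfl, rfl, rfl⟩
  refine Runs.seq (runs_write (Runs.seq (runs_write ?_)))
  simp only [Expr.eval, State.var_push, hj]
  refine runs_forLoop_out hα (fun i => [if i ∈ I.col (I.repEdge j) then 1 else 0]) rfl
    (fun s' hF => (hF.var 1 rfl).trans hI₁.colors) ?_ fun s' _ h => ?_
  · intro i s' hF' hi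
    refine runs_write ?_
    have a0 : s'.arr 0 = s₁.arr 0 := hF'.arr 0 rfl
    have a1 : s'.arr 1 = s₁.arr 1 := hF'.arr 1 rfl
    have a4 : s'.arr 4 = s₁.arr 4 := hF'.arr 4 rfl
    have h24 : s'.var 24 = j := (hF'.var 24 rfl).trans hj
    simp only [State.out_push, colE, Expr.eval, a0, a1, a4, h24, hi, hS₁.repEdge, hI₁.col]
  · rw [h, flatMap_singleton_eq_map, record_inl]
    simp

/-- Membership in the edges of the colour in register `10` that are not representatives. -/
def restCond : Expr := .sub (colE (.var 6) (.var 10)) (.arr 3 (.var 6))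

/-- Write the link at the vertex in register `23`. -/
def linkProg : Prog :=
  .seq (.assign 24 (.const 0))
    (.seq (.loop (neq (.arr 2 (.arr 5 (.var 24))) (.arr 2 (.arr 5 (.var 23))))
        (.assign 24 (.add (.var 24) (.const 1))))
      (.seq (.write (.var 23)) (.seq (.write (.var 24))
        (forLoop 25 (.var 1) (.write (.sub (.sub (.const 1) (neq (.var 25) (.var 10)))
          (.sub (.const 1) (neq (.var 24) (.var 23)))))))))

/-- Write all links. -/
def writeLinksProg : Prog :=
  forLoop 10 (.var 1) (.seq (componentsProg restCond) (forLoop 23 (.var 27) linkProg))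

lemma runs_linkProg (hI : Knows I s) (hα : I.numColors ≤ N) (hr : 2 * I.numReps ≤ N)
    (hS : Stores I I.reps s) {i : Fin I.numColors} {p : Fin (2 * I.numReps)}
    (hi : s.var 10 = i) (hp : s.var 23 = p) (hl : I.Labels (I.rest i) (s.arr 2)) :
    Runs N linkProg s fun s' => s'.out = s.out ++ I.record (.inr (i, p)) := by
  have hjoin : ∀ q : Fin (2 * I.numReps),
      s.arr 2 (s.arr 5 q) = s.arr 2 (s.arr 5 p) ↔ I.Joined i p q := by
    intro q
    rw [hS.orig, hS.orig, hl.eq_iff (orig_lt q) (orig_lt p)]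
    exact ⟨fun h => (show I.Joined i q p from h).symm, fun h => h.symm⟩
  refine Runs.seq (runs_assign (Runs.seq ?_))
  have hcond : ∀ s', Frame (.loop (neq (.arr 2 (.arr 5 (.var 24))) (.arr 2 (.arr 5 (.var 23))))
      (.assign 24 (.add (.var 24) (.const 1)))) (s.setVar 24 0) s' →
      ∀ q : Fin (2 * I.numReps), s'.var 24 = q →
      ((neq (.arr 2 (.arr 5 (.var 24))) (.arr 2 (.arr 5 (.var 23)))).eval s' = 0 ↔
        I.Joined i p q) := by
    intro s' hF q hq
    have a2 : s'.arr 2 = s.arr 2 := hF.arr 2 rfl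
    have a5 : s'.arr 5 = s.arr 5 := hF.arr 5 rfl
    have h23 : s'.var 23 = p := (hF.var 23 rfl).trans hp
    rw [← hjoin]
    simp only [eval_neq, Expr.eval, a2, a5, h23, hq]
    omega
  -- The search stops at a new vertex joined to `p`. It cannot stop before the anchor, which is the
  -- least such vertex, nor pass it, since the loop condition is zero there.
  refine runs_loop hr (fun j s' => s'.var 24 = j ∧ j ≤ I.anchor i p) (by simp) ?_ ?_
  · rintro j s₁ hF ⟨h24, hle⟩ he
    have hj : j < 2 * I.numReps := by omega
    have hjoined := (hcond s₁ hF ⟨j, hj⟩ h24).1 he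
    have hanchor : (I.anchor i p : ℕ) = j := by
      have : (I.anchor i p : ℕ) ≤ j := I.anchor_le hjoined
      omega
    have h23 : s₁.var 23 = p := (hF.var 23 rfl).trans hp
    have h10 : s₁.var 10 = i := (hF.var 10 rfl).trans hi
    have hout : s₁.out = s.out := hF.out rfl
    refine Runs.seq (runs_write (Runs.seq (runs_write ?_)))
    simp only [Expr.eval, State.var_push, h23, h24]
    refine runs_forLoop_out hα (fun i' => [1 - (((i' : ℕ) - i) + (i - i')) -
      (1 - (((I.anchor i p : ℕ) - p) + ((p : ℕ) - I.anchor i p)))]) rfl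
      (fun s' hF' => (hF'.var 1 rfl).trans ((hF.var 1 rfl).trans hI.colors)) ?_ fun s' _ h => ?_
    · intro i' s' hF' h25
      refine runs_write ?_
      have h24' : s'.var 24 = j := (hF'.var 24 rfl).trans h24
      have h23' : s'.var 23 = p := (hF'.var 23 rfl).trans h23
      have h10' : s'.var 10 = i := (hF'.var 10 rfl).trans h10
      simp only [State.out_push, Expr.eval, eval_neq, h24', h23', h10', h25, hanchor]
    · rw [h, flatMap_singleton_eq_map, record_inr]
      simp [hout, hanchor]
  · rintro j s₁ hF ⟨h24, hle⟩ he
    have hj : j < 2 * I.numReps := by omega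
    refine ⟨hj, runs_assign ⟨by simp [h24], ?_⟩⟩
    rcases hle.lt_or_eq with h | rfl
    · exact h
    · exact absurd ((hcond s₁ hF _ h24).2 (I.joined_anchor i p)) he

lemma runs_writeLinksProg (hI : Knows I s) (hn : I.numVertices ≤ N) (hM : I.numEdges ≤ N)
    (hα : I.numColors ≤ N) (hr : 2 * I.numReps ≤ N) (hS : Stores I I.reps s)
    (h27 : s.var 27 = 2 * I.numReps) :
    Runs N writeLinksProg s fun s' => s'.out = s.out ++
      (List.finRange I.numColors).flatMap fun i =>
        (List.finRange (2 * I.numReps)).flatMap fun p => I.record (.inr (i, p)) := by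
  classical
  refine runs_forLoop_out hα
    (fun i => (List.finRange (2 * I.numReps)).flatMap fun p => I.record (.inr (i, p))) rfl
    (fun s' hF => (hF.var 1 rfl).trans hI.colors) ?_ fun s' _ h => h
  intro i s₁ hF hi
  have hI₁ := hI.frame hF ⟨rfl, rfl, rfl, rfl, rfl, rfl⟩
  have hS₁ := hS.frame hF rfl ⟨rfl, rfl, rfl⟩
  refine Runs.seq ((runs_componentsProg hI₁ hn hM ((I.colorEdges i).filter fun e => ¬ I.IsRep e)
    fun s' hF' e he => ?_).mono fun s₂ hF₂ h₂ => ?_)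
  · have hc := (hI₁.frame hF' ⟨rfl, rfl, rfl, rfl, rfl, rfl⟩).col e i
    have hm := (hS₁.frame hF' rfl ⟨rfl, rfl, rfl⟩).mark e
    simp only [mem_reps] at hm
    have h10 : s'.var 10 = i := (hF'.var 10 rfl).trans hi
    simp only [restCond, colE, Expr.eval, he, h10, hc, hm, colorEdges, Finset.mem_filter,
      Finset.mem_univ, true_and]
    by_cases h1 : i ∈ I.col e <;> by_cases h2 : I.IsRep e <;> simp [h1, h2]
  · have hl : I.Labels (I.rest i) (s₂.arr 2) := by
      have := h₂.1
      rwa [Finset.coe_filter] at this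
    have hI₂ := hI₁.frame hF₂ ⟨rfl, rfl, rfl, rfl, rfl, rfl⟩
    have hS₂ := hS₁.frame hF₂ rfl ⟨rfl, rfl, rfl⟩
    have hout : s₂.out = s₁.out := hF₂.out rfl
    rw [← hout]
    refine runs_forLoop_out hr (fun p => I.record (.inr (i, p))) rfl
      (fun s' hF' => (hF'.var 27 rfl).trans
        ((hF₂.var 27 rfl).trans ((hF.var 27 rfl).trans h27))) ?_ fun s' _ h => h
    intro p s₃ hF₃ h23
    refine runs_linkProg (hI₂.frame hF₃ ⟨rfl, rfl, rfl, rfl, rfl, rfl⟩) hα hr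
      (hS₂.frame hF₃ rfl ⟨rfl, rfl, rfl⟩)
      ((hF₃.var 10 rfl).trans ((hF₂.var 10 rfl).trans hi)) h23 ?_
    rw [hF₃.arr 2 rfl]
    exact hl

end RAM

/-! ### The whole program -/

namespace SimFES.Instance

variable (I : Instance)

lemma getElem?_flatMap_of_length {α β : Type*} {f : α → List β} {w : ℕ} (l : List α)
    (hl : ∀ x ∈ l, (f x).length = w) (e : ℕ) {i : ℕ} (hi : i < w) :
    (l.flatMap f)[e * w + i]? = (l[e]?).bind fun x => (f x)[i]? := by
  induction l generalizing e with
  | nil => simp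
  | cons x l ih =>
    have hx : (f x).length = w := hl x (by simp)
    rw [List.flatMap_cons]
    cases e with
    | zero => rw [zero_mul, zero_add, List.getElem?_append_left (by omega)]; simp
    | succ e =>
      rw [Nat.succ_mul, List.getElem?_append_right (by omega), hx,
        show e * w + w + i - w = e * w + i by omega, ih fun y hy => hl y (by simp [hy])]
      simp

lemma encode_getD (e : Fin I.numEdges) {i : ℕ} (hi : i < 2 + I.numColors) :
    I.encode.getD (4 + I.numVertices + e * (2 + I.numColors) + i) 0 =
      ([((I.ends e).1 : ℕ), ((I.ends e).2 : ℕ)] ++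
        (List.finRange I.numColors).map fun i => if i ∈ I.col e then 1 else 0).getD i 0 := by
  rw [List.getD_eq_getElem?_getD, List.getD_eq_getElem?_getD, encode,
    List.getElem?_append_right (by simp; omega)]
  have hlen : ([I.numColors, I.budget, I.numVertices, I.numEdges] ++
      List.range I.numVertices).length = 4 + I.numVertices := by
    simp
    omega
  rw [hlen, show 4 + I.numVertices + e * (2 + I.numColors) + i - (4 + I.numVertices) =
    e * (2 + I.numColors) + i by omega, getElem?_flatMap_of_length _ _ _ hi]
  · simp
  · intro x _
    simp
    omega

lemma encode_header : I.encode.getD 0 0 = I.numColors ∧ I.encode.getD 1 0 = I.budget ∧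
    I.encode.getD 2 0 = I.numVertices ∧ I.encode.getD 3 0 = I.numEdges := ⟨rfl, rfl, rfl, rfl⟩

lemma length_encode_le_bitLength : I.encode.length ≤ RAM.bitLength I.encode := by
  rw [RAM.bitLength]
  have := List.card_nsmul_le_sum (I.encode.map fun x => Nat.size x + 1) 1 fun y hy => by
    obtain ⟨x, -, rfl⟩ := List.mem_map.1 hy
    omega
  simpa only [smul_eq_mul, mul_one, List.length_map] using this

lemma numReps_le_numEdges : I.numReps ≤ I.numEdges := by
  classical
  have := List.length_filter_le (fun e => decide (I.IsRep e)) (List.finRange I.numEdges)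
  rwa [List.length_finRange] at this

lemma encode_trivialYes (α : ℕ) : (trivialYes α).encode = [α, 0, 0, 0] := by
  rw [trivialYes, encode_ofEdges]
  simp

lemma encode_trivialNo (α : ℕ) :
    (trivialNo α).encode = [α, 0, 1, 1, 0, 0, 0] ++ (List.finRange α).map fun _ => 1 := by
  rw [trivialNo, encode_ofEdges]
  simp

end SimFES.Instance

namespace RAM

open SimFES SimFES.Instance

variable {I : Instance} {N : ℕ} {s : State}

/-- Read the four numbers at the beginning of the input. -/
def readProg : Prog :=
  .seq (.assign 1 (.arr 0 (.const 0))) (.seq (.assign 2 (.arr 0 (.const 1)))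
    (.seq (.assign 3 (.arr 0 (.const 2))) (.assign 4 (.arr 0 (.const 3)))))

/-- Compute the positions of the edges in the input. -/
def parseProg : Prog :=
  .seq (.assign 26 (.add (.const 4) (.var 3))) (forLoop 6 (.var 4)
    (.seq (.store 1 (.var 6) (.var 26)) (.assign 26 (.add (.var 26) (.add (.const 2) (.var 1))))))

/-- An edge occupies `2 + α` consecutive entries after the header and the vertex list. Its position
is found by repeated addition and kept in array `1`, which replaces multiplication in every later
access. -/
lemma runs_parseProg (hM : I.numEdges ≤ N) (h0 : ∀ j, s.arr 0 j = I.encode.getD j 0)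
    (h1 : s.var 1 = I.numColors) (h2 : s.var 2 = I.budget) (h3 : s.var 3 = I.numVertices)
    (h4 : s.var 4 = I.numEdges) : Runs N parseProg s (Knows I) := by
  refine Runs.seq (runs_assign ?_)
  refine runs_forLoop hM (fun j s' =>
    s'.var 26 = 4 + I.numVertices + j * (2 + I.numColors) ∧
      ∀ t < j, s'.arr 1 t = 4 + I.numVertices + t * (2 + I.numColors)) rfl
    (fun s' hF => (hF.var 4 rfl).trans h4) (by simp [h3]) (fun j s' x h => by simpa using h) ?_ ?_
  · rintro j hj s' hF h6 ⟨h26, hinv⟩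
    have h1' : s'.var 1 = I.numColors := (hF.var 1 rfl).trans h1
    refine Runs.seq (runs_store (runs_assign ⟨?_, fun t ht => ?_⟩))
    · simp only [Expr.eval, State.var_setVar, State.var_setArr, h26, h1', if_true]
      ring
    · simp only [State.arr_setVar, State.arr_setArr, Expr.eval, h6, h26, true_and]
      split_ifs with h
      · rw [h]
      · exact hinv t (by omega)
  · rintro s' hF ⟨-, hinv⟩
    have a0 : s'.arr 0 = s.arr 0 := hF.arr 0 rfl
    refine ⟨(hF.var 1 rfl).trans h1, (hF.var 2 rfl).trans h2, (hF.var 3 rfl).trans h3,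
      (hF.var 4 rfl).trans h4, fun e => ?_, fun e => ?_, fun e i => ?_⟩
    · have := I.encode_getD e (i := 0) (by omega)
      rw [add_zero] at this
      rw [hinv e e.2, a0, h0, this]
      rfl
    · have := I.encode_getD e (i := 1) (by omega)
      rw [hinv e e.2, a0, h0, this]
      rfl
    · have := I.encode_getD e (i := 2 + i) (by omega)
      rw [hinv e e.2, a0, h0, this]
      rw [List.getD_eq_getElem?_getD, List.getElem?_append_right (by simp)]
      simp

/-- Write a yes-instance. -/
def yesProg : Prog :=
  .seq (.write (.var 1)) (.seq (.write (.const 0)) (.seq (.write (.const 0)) (.write (.const 0))))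

/-- Write a no-instance. -/
def noProg : Prog :=
  .seq (.write (.var 1)) (.seq (.write (.const 0)) (.seq (.write (.const 1))
    (.seq (.write (.const 1)) (.seq (.write (.const 0)) (.seq (.write (.const 0))
      (.seq (.write (.const 0)) (forLoop 10 (.var 1) (.write (.const 1)))))))))

lemma runs_yesProg (h1 : s.var 1 = I.numColors) :
    Runs N yesProg s fun s' => s'.out = s.out ++ (trivialYes I.numColors).encode := by
  refine Runs.seq (runs_write (Runs.seq (runs_write (Runs.seq (runs_write (runs_write ?_))))))
  simp [encode_trivialYes, h1]

lemma runs_noProg (hα : I.numColors ≤ N) (h1 : s.var 1 = I.numColors) :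
    Runs N noProg s fun s' => s'.out = s.out ++ (trivialNo I.numColors).encode := by
  refine Runs.seq (runs_write (Runs.seq (runs_write (Runs.seq (runs_write (Runs.seq (runs_write
    (Runs.seq (runs_write (Runs.seq (runs_write (Runs.seq (runs_write ?_)))))))))))))
  refine runs_forLoop_out hα (fun _ => [1]) rfl (fun s' hF => (hF.var 1 rfl).trans h1)
    (fun i s' _ _ => runs_write (by simp)) fun s' _ h => ?_
  rw [h, flatMap_singleton_eq_map, encode_trivialNo]
  simp [h1]

/-- Write the compressed instance. -/
def compressProg : Prog :=
  .seq repsProg (.seq headerProg (.seq writeRepsProg writeLinksProg))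

lemma runs_compressProg (hI : Knows I s) (hn : I.numVertices ≤ N) (hM : I.numEdges ≤ N)
    (hα : I.numColors ≤ N) (hr : 2 * I.numReps ≤ N) (h3 : ∀ e, s.arr 3 e = 0) :
    Runs N compressProg s fun s' => s'.out = s.out ++ I.compressed.encode := by
  refine Runs.seq ((runs_repsProg hI hn hM hα h3).mono fun s₁ hF₁ hS₁ => ?_)
  have hI₁ := hI.frame hF₁ ⟨rfl, rfl, rfl, rfl, rfl, rfl⟩
  have o₁ : s₁.out = s.out := hF₁.out rfl
  refine Runs.seq ((runs_headerProg hI₁ hα hr hS₁).mono fun s₂ hF₂ h₂ => ?_)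
  have hI₂ := hI₁.frame hF₂ ⟨rfl, rfl, rfl, rfl, rfl, rfl⟩
  have hS₂ := hS₁.frame hF₂ rfl ⟨rfl, rfl, rfl⟩
  refine Runs.seq ((runs_writeRepsProg hI₂ hα hr hS₂).mono fun s₃ hF₃ h₃ => ?_)
  have hI₃ := hI₂.frame hF₃ ⟨rfl, rfl, rfl, rfl, rfl, rfl⟩
  have hS₃ := hS₂.frame hF₃ rfl ⟨rfl, rfl, rfl⟩
  refine (runs_writeLinksProg hI₃ hn hM hα hr hS₃ ((hF₃.var 27 rfl).trans h₂.1)).mono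
    fun s₄ _ h₄ => ?_
  rw [h₄, h₃, h₂.2, o₁, encode_compressed]
  simp only [List.append_assoc]

/-- Write the kernel of an instance with at least one edge. -/
def mainProg : Prog :=
  .seq parseProg (.seq countProg (.ite (.sub (.var 13) (.var 2))
    (.ite (.var 14) noProg compressProg) yesProg))

/-- The kernelization program. -/
def kernelProg : Prog := .seq readProg (.ite (.var 4) mainProg yesProg)

lemma runs_mainProg (hn : I.numVertices ≤ N) (hM : I.numEdges ≤ N)
    (hα : I.numColors ≤ N) (hr : 2 * I.numReps ≤ N) (h0 : ∀ j, s.arr 0 j = I.encode.getD j 0)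
    (h1 : s.var 1 = I.numColors) (h2 : s.var 2 = I.budget) (h3 : s.var 3 = I.numVertices)
    (h4 : s.var 4 = I.numEdges) (h13 : s.var 13 = 0) (h14 : s.var 14 = 0)
    (ha3 : ∀ e, s.arr 3 e = 0) :
    Runs N mainProg s fun s' => s'.out = s.out ++ I.kernel.encode := by
  refine Runs.seq ((runs_parseProg hM h0 h1 h2 h3 h4).mono fun s₁ hF₁ hI₁ => ?_)
  refine Runs.seq ((runs_countProg hI₁ hn hM hα ((hF₁.var 13 rfl).trans h13)
    ((hF₁.var 14 rfl).trans h14)).mono fun s₂ hF₂ h₂ => ?_)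
  have hI₂ := hI₁.frame hF₂ ⟨rfl, rfl, rfl, rfl, rfl, rfl⟩
  have ho : s₂.out = s.out := (hF₂.out rfl).trans (hF₁.out rfl)
  rw [← ho, kernel]
  refine runs_ite (fun he => runs_ite (fun he' => ?_) fun he' => ?_) fun he => ?_
  · simp only [Expr.eval, h₂.1, hI₂.budget] at he
    rw [if_neg (by omega), if_pos (h₂.2.1 he')]
    exact runs_noProg hα hI₂.colors
  · simp only [Expr.eval, h₂.1, hI₂.budget] at he
    rw [if_neg (by omega), if_neg fun h => h₂.2.2 h he']
    refine runs_compressProg hI₂ hn hM hα hr fun e => ?_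
    rw [hF₂.arr 3 rfl, hF₁.arr 3 rfl, ha3]
  · simp only [Expr.eval, h₂.1, hI₂.budget] at he
    rw [if_pos (by omega)]
    exact runs_yesProg hI₂.colors

lemma runs_kernelProg (I : Instance) :
    Runs (bitLength I.encode) kernelProg (State.init I.encode) fun s' =>
      s'.out = I.kernel.encode := by
  have hN := I.length_encode_le_bitLength
  rw [length_encode] at hN
  obtain ⟨e0, e1, e2, e3⟩ := I.encode_header
  refine Runs.seq (Runs.seq (runs_assign (Runs.seq (runs_assign (Runs.seq (runs_assign
    (runs_assign ?_)))))))
  have ha0 : (State.init I.encode).arr 0 = fun j => I.encode.getD j 0 := by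
    simp [State.init]
  simp only [Expr.eval, State.arr_setVar, ha0, e0, e1, e2, e3]
  refine runs_ite (fun he => ?_) fun he => ?_
  · simp only [Expr.eval, State.var_setVar, if_true] at he
    -- As soon as there is an edge, the input contains a characteristic vector of length `α`, so
    -- loops over the colours are bounded by the input length.
    have hle : 2 + I.numColors ≤ I.numEdges * (2 + I.numColors) :=
      Nat.le_mul_of_pos_left _ (by omega)
    have hle' : I.numEdges * 2 ≤ I.numEdges * (2 + I.numColors) :=
      Nat.mul_le_mul_left _ (by omega)
    have hr := I.numReps_le_numEdges
    refine (runs_mainProg (I := I) (by omega) (by omega) (by omega) (by omega) ?_ ?_ ?_ ?_ ?_ ?_ ?_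
      ?_).mono fun s' _ h => ?_
    · simp [ha0]
    · simp
    · simp
    · simp
    · simp
    · simp [State.init]
    · simp [State.init]
    · simp [State.init]
    · simpa [State.init] using h
  · simp only [Expr.eval, State.var_setVar, if_true] at he
    -- Without edges `α` can be exponential in the input length, so no loop may run over the
    -- colours. All nullities vanish and the first case of `kernel` applies directly.
    have hsum : ∑ i, I.colorNullity i ≤ I.budget := by
      refine (Finset.sum_eq_zero fun i _ => ?_).trans_le (Nat.zero_le _)
      have := Finset.card_le_univ (I.colorEdges i)
      rw [Fintype.card_fin] at this
      rw [colorNullity, nullity]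
      omega
    refine (runs_yesProg (I := I) (by simp)).mono fun s' _ h => ?_
    rw [kernel, if_pos hsum, h]
    simp [State.init]

end RAM

theorem mainTheorem5 :
    ∃ (K : SimFES.Instance → SimFES.Instance) (c : ℕ),
      IsKernelization SimFES.Instance.encode SimFES.Instance.IsYes SimFES.Instance.param K ∧
        ∀ I : SimFES.Instance,
          (K I).numColors = I.numColors ∧ (K I).budget ≤ I.budget ∧
            (K I).numVertices ≤ max 1 (I.budget * I.numColors) ^ (c * I.numColors) := by
  refine ⟨SimFES.Instance.kernel, 4, ⟨⟨RAM.kernelProg, RAM.kernelProg.boundPoly, fun I => ?_⟩,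
    SimFES.Instance.isYes_kernel, SimFES.sizeBound, SimFES.primrec_sizeBound.to_comp,
    SimFES.bitLength_kernel_le⟩, fun I => ⟨I.numColors_kernel, I.budget_kernel_le,
      I.numVertices_kernel_le⟩⟩
  obtain ⟨t, s, he, ht, hs⟩ := RAM.runs_kernelProg I
  exact ⟨t, s, he, hs, ht⟩
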